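/- **Setting.** Let $T$ be an abelian group acting by homeomorphisms, minimally, on a compact Hausdorff space $X$, and let $\pi_{eq}:X\to X_{eq}$ be its maximal equicontinuous factor, where $X_{eq}$ carries an abelian topological group structure (written additively, with neutral element $0$) for which $T$ acts by translations. Let $\mathfrak a$ be the group of homeomorphisms of $X$ commuting with the action; each $\alpha\in\mathfrak a$ induces a map $\alpha_{eq}$ of $X_{eq}$ with $\alpha_{eq}\circ\pi_{eq}=\pi_{eq}\circ\alpha$, and $\mathfrak a_{eq}=\{\alpha_{eq}:\alpha\in\mathfrak a\}$. A point $\xi\in X_{eq}$ is *singular* if $\pi_{eq}^{-1}(\xi)$ contains two distinct proximal points. The system is *USF* (unique singular fibre) if the set of singular points equals the orbit $\mathfrak a_{eq}(0)=\{\alpha_{eq}(0):\alpha\in\mathfrak a\}$. Let $E=E(X)$ be the Ellis semigroup (the closure of the set of maps $x\mapsto t\cdot x$, $t\in T$, in $X^X$ with the topology of pointwise convergence, under composition), and let $\mathcal M(X)$ be its kernel, i.e. its smallest two-sided ideal. Let $\mathcal M^{fib}(X)$ be the subsemigroup of those $f\in\mathcal M(X)$ with $\pi_{eq}\circ f=\pi_{eq}$,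 and $\mathcal M^{fib}_0(X)$ the semigroup of restrictions of its elements to $\pi_{eq}^{-1}(0)$. Fix a minimal idempotent $e\in E$, and put $Y=e\,\pi_{eq}^{-1}(0)$. Let $\mathcal G=eEe$ be the structure group, regarded as a group of permutations of $eX$, and $\mathcal G^{fib}=\{g\in\mathcal G:\pi_{eq}\circ g=\pi_{eq}\}$. Let $\Gamma\subset\mathcal G^{fib}$ be the little structure group, generated by all products $qp$ with $p,q$ idempotents of $\mathcal M(X)$, $p\in Ee$, $q\in eE$; and let $\mathcal G^{fib}_0,\Gamma_0\subset S_Y$ be the groups of restrictions of $\mathcal G^{fib},\Gamma$ to $Y$, where $S_Y$ is the group of all permutations of $Y$. The topological normal closure of $\Gamma_0$ in $\mathcal G^{fib}_0$ is the closure in $\mathcal G^{fib}_0$, for pointwise convergence on $Y$, of the smallest normal subgroup of $\mathcal G_0^{fib}$ containing $\Gamma_0$. For a group $G$, sets $I,\Lambda$ and a matrix $A=(a_{\lambda,i})_{\lambda\in\Lambda,i\in I}$ over $G$, the matrix semigroup $M(I,G,\Lambda;A)$ is $I\times G\times\Lambda$ with $(i,g,\lambda)(j,h,\mu)=(i,g\,a_{\lambda,j}\,h,\mu)$.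 **Proposition.** Suppose that the system is USF and that the topological normal closure of $\Gamma_0$ in $\mathcal G_0^{fib}$ contains all elements of $S_Y$. Then the algebraic structure of $\mathcal M(X)$ is determined by $\mathcal M_0^{fib}(X)$ and $X_{eq}$ (with its automorphisms) in the following sense. 1. $\mathcal G$ consists of all covariant functions $\tilde g$ on $X_{eq}$ whose values $\tilde g(\eta)$ are bijections $e\pi_{eq}^{-1}(\eta)\to e\pi_{eq}^{-1}(\eta+\xi)$, with $\xi\in X_{eq}$ depending only on $\tilde g$. Here covariance means $\alpha\,\tilde g(\eta)\,\alpha^{-1}=\tilde g(\alpha_{eq}(\eta))$ for all $\alpha\in\mathfrak a$, and the product is $(\tilde g\tilde g')(\eta)=\tilde g(\eta+\zeta)\,\tilde g'(\eta)$ with $\zeta$ the translation belonging to $\tilde g'$; an element $g\in\mathcal G$ corresponds to $\tilde g(\eta)=g|_{e\pi_{eq}^{-1}(\eta)}$. 2. There are $I$, $\Lambda$ and a matrix $A$ over $S_Y$ with $\mathcal M^{fib}_0(X)\cong M(I,S_Y,\Lambda;A)$. 3. Whenever $I$, $\Lambda$ and $A=(a_{\lambda,i})$ are such that $\mathcal M^{fib}_0(X)\cong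 M(I,S_Y,\Lambda;A)$, then $\mathcal M(X)\cong M(I,\mathcal G,\Lambda;\tilde A)$, where $\tilde a_{\lambda,i}\in\mathcal G$ is the covariant function with $$\tilde a_{\lambda,i}(\xi)=\begin{cases} a_{\lambda,i} & \text{if }\xi\in\mathfrak a_{eq}(0),\\ \mathrm{id}&\text{otherwise.}\end{cases}$$ Here the fibre over $\xi=\alpha_{eq}(0)$ is identified with the one over $0$ by means of $\alpha$, that is, $\tilde a_{\lambda,i}(\alpha_{eq}(0))=\alpha\,a_{\lambda,i}\,\alpha^{-1}$ for every $\alpha\in\mathfrak a$ (in particular, this does not depend on the choice of $\alpha$). All isomorphisms are isomorphisms of abstract semigroups. -/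

import Mathlib

open Set Topology

universe u w

/-! ### Matrix semigroups -/

/-- The matrix semigroup `M(I, G, Λ; A)`: the set `I × G × Λ` with the product
`(i, g, l) (j, h, m) = (i, g * A l j * h, m)`. -/
@[ext] structure ReesMatrix {I G Λ : Type*} (A : Λ → I → G) where
  row : I
  val : G
  col : Λ

instance {I G Λ : Type*} [Group G] (A : Λ → I → G) : Semigroup (ReesMatrix A) where
  mul x y := ⟨x.row, x.val * A x.col y.row * y.val, y.col⟩
  mul_assoc x y z := by
    change ReesMatrix.mk _ _ _ = ReesMatrix.mk _ _ _
    congr 1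
    change (x.val * A x.col y.row * y.val) * A y.col z.row * z.val
      = x.val * A x.col y.row * (y.val * A y.col z.row * z.val)
    simp only [mul_assoc]

/-! ### Dynamical systems -/

section Dynamics

variable (T : Type w) [CommGroup T]

/-- Proximality in a compact Hausdorff system, with respect to the unique compatible
uniformity: the orbits of `x` and `y` come simultaneously arbitrarily close. -/
def Proximal {X : Type u} [TopologicalSpace X] [CompactSpace X] [T2Space X] [MulAction T X]
    (x y : X) : Prop :=
  letI : UniformSpace X := uniformSpaceOfCompactR1
  ∀ U ∈ uniformity X, ∃ t : T, (t • x, t • y) ∈ U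

/-- The family of maps `y ↦ t • y`, `t ∈ T`, is equicontinuous (with respect to the unique
compatible uniformity of the compact Hausdorff space `Y`). -/
def IsEquicontinuousSystem (Y : Type u) [TopologicalSpace Y] [CompactSpace Y] [T2Space Y]
    [MulAction T Y] : Prop :=
  letI : UniformSpace Y := uniformSpaceOfCompactR1
  Equicontinuous (fun (t : T) (y : Y) => t • y)

/-- A factor map: a continuous equivariant surjection. -/
structure IsFactorMap {X Y : Type u} [TopologicalSpace X] [TopologicalSpace Y]
    [MulAction T X] [MulAction T Y] (φ : X → Y) : Prop where
  continuous : Continuous φ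
  surjective : Function.Surjective φ
  map_smul : ∀ (t : T) (x : X), φ (t • x) = t • φ x

/-- `π : X → Z` is a maximal equicontinuous factor of `X`: it is an equicontinuous factor and
every equicontinuous factor of `X` factors through it. -/
structure IsMaximalEquicontinuousFactor {X Z : Type u}
    [TopologicalSpace X] [MulAction T X]
    [TopologicalSpace Z] [CompactSpace Z] [T2Space Z] [MulAction T Z] (π : X → Z) : Prop where
  isFactorMap : IsFactorMap T π
  equicontinuous : IsEquicontinuousSystem T Z
  universal : ∀ (Y : Type u) [TopologicalSpace Y] [CompactSpace Y] [T2Space Y] [MulAction T Y]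
    [ContinuousConstSMul T Y], IsEquicontinuousSystem T Y →
    ∀ φ : X → Y, IsFactorMap T φ → ∃ ψ : Z → Y, IsFactorMap T ψ ∧ φ = ψ ∘ π

/-- The automorphism group `𝔞` of a system: the homeomorphisms that commute with the action. -/
def autGroup (X : Type u) [TopologicalSpace X] [MulAction T X] : Subgroup (X ≃ₜ X) where
  carrier := {α | ∀ (t : T) (x : X), α (t • x) = t • α x}
  one_mem' := fun _ _ => rfl
  mul_mem' := by
    intro α β hα hβ t x
    change α (β (t • x)) = t • α (β x)
    rw [hβ, hα]
  inv_mem' := by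
    intro α hα t x
    change α.symm (t • x) = t • α.symm x
    rw [Homeomorph.symm_apply_eq, hα, Homeomorph.apply_symm_apply]

/-- The orbit of `ξ` under the group `𝔞_eq` of the maps `α_eq` induced on the maximal
equicontinuous factor by the automorphisms `α`; here `α_eq ξ = π (α x)` for any `x` with
`π x = ξ`. -/
def autEqOrbit {X Z : Type u} [TopologicalSpace X] [MulAction T X] (π : X → Z) (ξ : Z) : Set Z :=
  {η | ∃ α ∈ autGroup T X, ∃ x : X, π x = ξ ∧ π (α x) = η}

/-- A point of the factor is singular if its fibre contains two distinct proximal points. -/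
def singularPoints {X Z : Type u} [TopologicalSpace X] [CompactSpace X] [T2Space X]
    [MulAction T X] (π : X → Z) : Set Z :=
  {ξ | ∃ x y : X, π x = ξ ∧ π y = ξ ∧ x ≠ y ∧ Proximal T x y}

/-- Unique singular fibre systems: the singular points are exactly the `𝔞_eq`-orbit of `0`. -/
def IsUSF {X Z : Type u} [TopologicalSpace X] [CompactSpace X] [T2Space X]
    [MulAction T X] [Zero Z] (π : X → Z) : Prop :=
  singularPoints T π = autEqOrbit T π 0

/-! ### The Ellis semigroup and its kernel -/

/-- The closure of `{x ↦ t • x | t ∈ T}` in the space of all maps `X → X` with the topology of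
pointwise convergence. -/
def ellisSet (X : Type u) [TopologicalSpace X] [MulAction T X] : Set (X → X) :=
  closure (range fun (t : T) (x : X) => t • x)

theorem comp_mem_ellisSet {X : Type u} [TopologicalSpace X] [MulAction T X]
    [ContinuousConstSMul T X] {f g : X → X} (hf : f ∈ ellisSet T X) (hg : g ∈ ellisSet T X) :
    f ∘ g ∈ ellisSet T X := by
  have h1 : ∀ t : T, (fun x => t • g x) ∈ ellisSet T X := by
    intro t
    have hc : Continuous (fun k : X → X => fun x => t • k x) :=
      continuous_pi fun x => (continuous_apply x).const_smul t
    refine map_mem_closure hc hg ?_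
    rintro _ ⟨s, rfl⟩
    exact ⟨t * s, by funext x; exact mul_smul t s x⟩
  have hc : Continuous (fun k : X → X => fun x => k (g x)) :=
    continuous_pi fun x => continuous_apply _
  have h2 := map_mem_closure (t := ellisSet T X) hc hf (by
    rintro _ ⟨t, rfl⟩
    exact h1 t)
  rw [ellisSet, closure_closure] at h2
  exact h2

theorem id_mem_ellisSet {X : Type u} [TopologicalSpace X] [MulAction T X] :
    (id : X → X) ∈ ellisSet T X :=
  subset_closure ⟨1, by funext x; exact one_smul T x⟩

/-- The Ellis semigroup `E(X)`: the closure of `{x ↦ t • x | t ∈ T}` in the space of all maps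
`X → X`, with composition as product. -/
def ellis (X : Type u) [TopologicalSpace X] [MulAction T X] [ContinuousConstSMul T X] :
    Submonoid (Function.End X) where
  carrier := ellisSet T X
  one_mem' := id_mem_ellisSet T
  mul_mem' := fun hf hg => comp_mem_ellisSet T hf hg

/-- A nonempty two-sided ideal of a subsemigroup `E` of the semigroup of all maps. -/
structure IsBilateralIdeal {X : Type u} (E : Submonoid (Function.End X))
    (J : Set (Function.End X)) : Prop where
  subset : J ⊆ E
  nonempty : J.Nonempty
  mul_mem_left : ∀ f ∈ E, ∀ g ∈ J, f * g ∈ J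
  mul_mem_right : ∀ f ∈ E, ∀ g ∈ J, g * f ∈ J

/-- The kernel `M(X)`: the smallest two-sided ideal of the Ellis semigroup. -/
def ellisKernel (X : Type u) [TopologicalSpace X] [MulAction T X] [ContinuousConstSMul T X] :
    Subsemigroup (Function.End X) where
  carrier := {f | f ∈ ellis T X ∧ ∀ J, IsBilateralIdeal (ellis T X) J → f ∈ J}
  mul_mem' := fun hf hg =>
    ⟨mul_mem hf.1 hg.1, fun J hJ => hJ.mul_mem_left _ hf.1 _ (hg.2 J hJ)⟩

/-- `M^fib(X)`: the elements of the kernel that preserve all fibres of `π`. -/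
def fibKernel {X Z : Type u} [TopologicalSpace X] [MulAction T X] [ContinuousConstSMul T X]
    (π : X → Z) : Subsemigroup (Function.End X) where
  carrier := {f | f ∈ ellisKernel T X ∧ ∀ x, π (f x) = π x}
  mul_mem' := fun {_ g} hf hg => ⟨mul_mem hf.1 hg.1, fun x => (hf.2 (g x)).trans (hg.2 x)⟩

/-- `M^fib_0(X)`: the semigroup of the restrictions of the elements of `M^fib(X)` to the fibre
of `0`. -/
def fibKernelZero {X Z : Type u} [TopologicalSpace X] [MulAction T X] [ContinuousConstSMul T X]
    [Zero Z] (π : X → Z) : Subsemigroup (Function.End (π ⁻¹' {0})) where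
  carrier := {h | ∃ f ∈ fibKernel T π, ∀ x : π ⁻¹' {0}, (h x : X) = f x}
  mul_mem' := by
    rintro h k ⟨f, hf, hhf⟩ ⟨g, hg, hkg⟩
    refine ⟨f * g, mul_mem hf hg, fun x => ?_⟩
    change (h (k x) : X) = f (g x)
    rw [hhf, hkg]

variable {T}
variable {X Z : Type u} [TopologicalSpace X] [MulAction T X] [ContinuousConstSMul T X]

/-- A minimal idempotent `e` of the Ellis semigroup: an idempotent such that every idempotent `p`
with `e p = p e = p` equals `e`. -/
def IsMinimalIdempotent (e : ellis T X) : Prop :=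
  IsIdempotentElem e ∧ ∀ p : ellis T X, IsIdempotentElem p → e * p = p → p * e = p → p = e

/-! ### The structure group and the little structure group

Elements of the group `𝒢 = e E e` are determined by their restriction to `e X`, on which they act
as permutations; groups are realised as groups of permutations of `e X`. -/

/-- The set `e X`. -/
def eRange (e : ellis T X) : Set X := range (e.1 : X → X)

/-- The set `e π⁻¹(0)`. -/
def eFibre [Zero Z] (π : X → Z) (e : ellis T X) : Set X := (e.1 : X → X) '' (π ⁻¹' {0})

theorem eFibre_subset [Zero Z] (π : X → Z) (e : ellis T X) : eFibre π e ⊆ eRange e :=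
  image_subset_range _ _

/-- For a group `H` of permutations of `S` and `Y ⊆ S`, the group of all permutations of `Y` that
are restrictions of elements of `H`. -/
def restrictPerm {S Y : Set X} (hY : Y ⊆ S) (H : Subgroup (Equiv.Perm S)) :
    Subgroup (Equiv.Perm Y) where
  carrier := {h | ∃ g ∈ H, ∀ y : Y, g (inclusion hY y) = inclusion hY (h y)}
  one_mem' := ⟨1, H.one_mem, fun _ => rfl⟩
  mul_mem' := by
    rintro h k ⟨f, hf, hhf⟩ ⟨g, hg, hkg⟩
    refine ⟨f * g, H.mul_mem hf hg, fun y => ?_⟩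
    rw [Equiv.Perm.mul_apply, hkg, hhf, Equiv.Perm.mul_apply]
  inv_mem' := by
    rintro h ⟨g, hg, hhg⟩
    refine ⟨g⁻¹, H.inv_mem hg, fun y => ?_⟩
    rw [Equiv.Perm.inv_eq_iff_eq, hhg]
    exact congrArg _ (Equiv.apply_symm_apply h y).symm

/-- The structure group `𝒢 = e E e`, acting on `e X`: the permutations of `e X` which, together
with their inverses, are restrictions of elements of `e E e`. (For a minimal idempotent `e`,
`e E e` is a group, so the inverses are automatically of this form.) -/
def structureGroup (e : ellis T X) (he : IsMinimalIdempotent e) :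
    Subgroup (Equiv.Perm (eRange e)) where
  carrier := {g | (∃ f : ellis T X, ∀ x, (g x : X) = (e * f * e).1 x) ∧
    (∃ f : ellis T X, ∀ x, ((g⁻¹ : Equiv.Perm (eRange e)) x : X) = (e * f * e).1 x)}
  one_mem' := by
    have h : ∀ x : eRange e, (x : X) = (e * 1 * e).1 x := by
      rintro ⟨_, y, rfl⟩
      have h2 : e * 1 * e * e = e := by
        rw [mul_one, mul_assoc, he.1.eq, he.1.eq]
      exact (congrFun (congrArg Subtype.val h2) y).symm
    exact ⟨⟨1, h⟩, ⟨1, by simpa using h⟩⟩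
  mul_mem' := by
    have key : ∀ g k : Equiv.Perm (eRange e),
        (∃ f : ellis T X, ∀ x, (g x : X) = (e * f * e).1 x) →
        (∃ f : ellis T X, ∀ x, (k x : X) = (e * f * e).1 x) →
        ∃ f : ellis T X, ∀ x, ((g * k) x : X) = (e * f * e).1 x := by
      rintro g k ⟨f, hf⟩ ⟨f', hf'⟩
      refine ⟨f * e * (e * f'), fun x => ?_⟩
      rw [Equiv.Perm.mul_apply, hf, hf']
      have h2 : e * (f * e * (e * f')) * e = (e * f * e) * (e * f' * e) := by
        simp only [mul_assoc]
      rw [h2]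
      rfl
    rintro g k ⟨h1, h2⟩ ⟨h3, h4⟩
    exact ⟨key g k h1 h3, by rw [mul_inv_rev]; exact key _ _ h4 h2⟩
  inv_mem' := by
    rintro g ⟨h1, h2⟩
    exact ⟨h2, by simpa using h1⟩

/-- `𝒢^fib`: the elements of the structure group that preserve all fibres of `π`. -/
def structureGroupFib (π : X → Z) (e : ellis T X) (he : IsMinimalIdempotent e) :
    Subgroup (Equiv.Perm (eRange e)) where
  carrier := {g | g ∈ structureGroup e he ∧ ∀ x, π (g x) = π x}
  one_mem' := ⟨one_mem _, fun _ => rfl⟩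
  mul_mem' := fun {_ k} hg hk => ⟨mul_mem hg.1 hk.1, fun x => (hg.2 (k x)).trans (hk.2 x)⟩
  inv_mem' := fun {g} hg => ⟨inv_mem hg.1, fun x => by
    have h := hg.2 (g⁻¹ x)
    rw [show g (g⁻¹ x) = x from Equiv.apply_symm_apply g x] at h
    exact h.symm⟩

/-- The little structure group `Γ`: the subgroup of `𝒢` generated by the entries `q p` of the
sandwich matrix (normalised at `e`) of the kernel, where `p` runs through the idempotents of the
kernel in the minimal left ideal `E e` and `q` through those in the minimal right ideal `e E`. -/
def littleStructureGroup (e : ellis T X) : Subgroup (Equiv.Perm (eRange e)) :=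
  Subgroup.closure {g | ∃ p q : ellis T X,
    (p.1 ∈ ellisKernel T X ∧ IsIdempotentElem p ∧ p * e = p) ∧
    (q.1 ∈ ellisKernel T X ∧ IsIdempotentElem q ∧ e * q = q) ∧
    ∀ x, (g x : X) = (q * p).1 x}

/-- `𝒢^fib_0`: the restriction of `𝒢^fib` to `e π⁻¹(0)`. -/
def structureGroupFibZero [Zero Z] (π : X → Z) (e : ellis T X) (he : IsMinimalIdempotent e) :
    Subgroup (Equiv.Perm (eFibre π e)) :=
  restrictPerm (eFibre_subset π e) (structureGroupFib π e he)

/-- `Γ_0`: the restriction of `Γ` to `e π⁻¹(0)`. -/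
def littleStructureGroupZero [Zero Z] (π : X → Z) (e : ellis T X) :
    Subgroup (Equiv.Perm (eFibre π e)) :=
  restrictPerm (eFibre_subset π e) (littleStructureGroup e)

/-- The topological normal closure of `H` in `G`, for groups `H ≤ G` of permutations of `Y ⊆ X`:
the closure in `G`, for the topology of pointwise convergence on `Y`, of the smallest normal
subgroup of `G` that contains `H`. -/
def topNormalClosure {Y : Set X} (G H : Subgroup (Equiv.Perm Y)) : Set (Equiv.Perm Y) :=
  {h | h ∈ G ∧ (h : Y → Y) ∈ closure ((fun k : Equiv.Perm Y => (k : Y → Y)) ''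
    ((Subgroup.normalClosure ((H.subgroupOf G : Subgroup G) : Set G)).map G.subtype :
      Set (Equiv.Perm Y)))}

/-! ### Covariant functions -/

/-- Elements of the Ellis semigroup commute with automorphisms. -/
theorem ellis_comm_aut (f : ellis T X) (α : autGroup T X) [T2Space X] (x : X) :
    α.1 (f.1 x) = f.1 (α.1 x) := by
  have hs : closure (range fun (t : T) (x : X) => t • x) ⊆
      {k : X → X | α.1 (k x) = k (α.1 x)} := by
    refine closure_minimal ?_ (isClosed_eq (α.1.continuous.comp (continuous_apply x))
      (continuous_apply _))
    rintro _ ⟨t, rfl⟩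
    exact α.2 t x
  exact hs f.2

/-- The restriction of an automorphism to `e X`. -/
def autRestrict [T2Space X] (e : ellis T X) (α : autGroup T X) : Equiv.Perm (eRange e) where
  toFun x := ⟨α.1 x, by
    obtain ⟨y, hy⟩ := x.2
    exact ⟨α.1 y, by rw [← hy, ellis_comm_aut]⟩⟩
  invFun x := ⟨α.1.symm x, by
    obtain ⟨y, hy⟩ := x.2
    refine ⟨α.1.symm y, ?_⟩
    have h := ellis_comm_aut e α (α.1.symm y)
    rw [Homeomorph.apply_symm_apply] at h
    rw [Homeomorph.eq_symm_apply, h, hy]⟩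
  left_inv x := Subtype.ext (α.1.symm_apply_apply x)
  right_inv x := Subtype.ext (α.1.apply_symm_apply x)

/-- The group of all covariant functions `g̃` on the maximal equicontinuous factor whose values
`g̃(η)` are bijections `e π⁻¹(η) → e π⁻¹(η + ξ)`, where `ξ` depends only on `g̃`; covariance means
`α g̃(η) α⁻¹ = g̃(α_eq η)` for all automorphisms `α`, and the product is
`(g̃ g̃')(η) = g̃(η + ζ) g̃'(η)` with `ζ` the translation of `g̃'`.
As `e X` is the disjoint union of the sets `e π⁻¹(η)`, such a function is a permutation of `e X`
which moves all fibres by one translation and commutes with all automorphisms, and the product is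
composition. -/
def covariantGroup [T2Space X] [AddCommGroup Z] (π : X → Z) (e : ellis T X) :
    Subgroup (Equiv.Perm (eRange e)) where
  carrier := {g | (∃ ξ : Z, ∀ x, π (g x) = π x + ξ) ∧
    ∀ (α : autGroup T X), autRestrict e α * g = g * autRestrict e α}
  one_mem' := ⟨⟨0, fun _ => (add_zero _).symm⟩, fun _ => by rw [mul_one, one_mul]⟩
  mul_mem' := by
    rintro g k ⟨⟨ξ, hg⟩, hg'⟩ ⟨⟨ζ, hk⟩, hk'⟩
    refine ⟨⟨ζ + ξ, fun x => ?_⟩, fun α => ?_⟩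
    · rw [Equiv.Perm.mul_apply, hg, hk, add_assoc]
    · rw [← mul_assoc, hg', mul_assoc, hk', mul_assoc]
  inv_mem' := by
    rintro g ⟨⟨ξ, hg⟩, hg'⟩
    refine ⟨⟨-ξ, fun x => ?_⟩, fun α => ?_⟩
    · have h := hg (g⁻¹ x)
      rw [show g (g⁻¹ x) = x from Equiv.apply_symm_apply g x] at h
      rw [h, add_neg_cancel_right]
    · rw [eq_inv_mul_iff_mul_eq, ← mul_assoc, ← hg', mul_inv_cancel_right]

/-- `b` is the covariant function with the value `a` on `𝔞_eq(0)` and the value identity elsewhere: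
`b(α_eq 0) = α a α⁻¹` for every automorphism `α` (this identifies the fibres over `𝔞_eq(0)` with
the one over `0`; for `α = 1` it reads `b(0) = a`), and `b(ξ) = id` for `ξ ∉ 𝔞_eq(0)`. -/
def IsCovariantExtension [T2Space X] [Zero Z] (π : X → Z) (e : ellis T X)
    (a : Equiv.Perm (eFibre π e)) (b : Equiv.Perm (eRange e)) : Prop :=
  (∀ (α : autGroup T X) (y : eFibre π e),
    b (autRestrict e α (inclusion (eFibre_subset π e) y)) =
      autRestrict e α (inclusion (eFibre_subset π e) (a y))) ∧
  (∀ x : eRange e, π x ∉ autEqOrbit T π 0 → b x = x)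

end Dynamics

/-! Elements of E(X) commute with 𝔞 and induce translations of X_eq, so 𝒢 consists of covariant
permutations of eX. An idempotent moves a point only inside its fibre and to a proximal point; by
USF it is therefore the identity on all fibres outside 𝔞_eq(0), and so are the products qp that
generate Γ.

Structure group (`structureGroup_eq`): a covariant permutation that is the identity on the regular
fibres is determined by its restriction to Y, continuously for pointwise convergence. Since 𝒢 is
closed, the density hypothesis on Γ₀ puts all such fibre-preserving permutations into 𝒢. Minimality
gives elements of 𝒢 with any translation; conjugating by them yields the covariant permutations
supported over any single orbit of 𝔞_eq. Finite products of these approximate every fibre-preserving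
covariant permutation, and closedness applies again.

Matrix form (`exists_kernel_matrix`): the kernel is EeE with eEe a group, hence a matrix semigroup
whose entries are the products qp of idempotents q in eE and p in Ee; the same holds for its
restriction to the fibre of 0, with group S_Y. An idempotent is determined over 𝔞_eq(0) by
covariance and is the identity elsewhere. So restriction identifies the index sets, and the entries
for the kernel are the extensions of those for the fibre.

Arbitrary matrices (`exists_mulEquiv_extension`): any other A agrees with this one up to row and
column factors and an automorphism φ of S_Y. The factors extend covariantly, but φ, which need not
be inner when |Y| = 6, must be extended too. If only the trivial automorphism of X preserves the
fibres, eX is equivariantly X_eq × Y and φ acts on the values of covariant functions. Otherwise a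
fibre-preserving automorphism restricts to a nontrivial central element of S_Y, so |Y| = 2 and φ is
trivial. -/

set_option linter.unusedSectionVars false

/-! ### Rees matrix semigroups -/

namespace ReesMatrix

section
variable {I G Λ : Type*} [Group G] {A : Λ → I → G}

@[simp] theorem mul_row (x y : ReesMatrix A) : (x * y).row = x.row := rfl
@[simp] theorem mul_col (x y : ReesMatrix A) : (x * y).col = y.col := rfl
@[simp] theorem mul_val (x y : ReesMatrix A) :
    (x * y).val = x.val * A x.col y.row * y.val := rfl

end

/-- Matrix semigroups over equivalent matrices are isomorphic. -/
def equivOfEquivalent {I G Λ I' G' Λ' : Type*} [Group G] [Group G']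
    {A : Λ → I → G} {A' : Λ' → I' → G'} (σ : I ≃ I') (τ : Λ ≃ Λ') (φ : G ≃* G')
    (u : I → G') (v : Λ → G') (h : ∀ l i, φ (A l i) = v l * A' (τ l) (σ i) * u i) :
    ReesMatrix A ≃* ReesMatrix A' where
  toFun x := ⟨σ x.row, u x.row * φ x.val * v x.col, τ x.col⟩
  invFun y := ⟨σ.symm y.row,
    φ.symm ((u (σ.symm y.row))⁻¹ * y.val * (v (τ.symm y.col))⁻¹), τ.symm y.col⟩
  left_inv x := by
    ext <;> simp [mul_assoc]
  right_inv y := by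
    ext <;> simp [mul_assoc]
  map_mul' x y := by
    ext
    · rfl
    · simp only [mul_val, mul_row, mul_col, map_mul, h, mul_assoc]
    · rfl

section
variable {I G Λ I' G' Λ' : Type*} [Group G] [Group G']
  {A : Λ → I → G} {A' : Λ' → I' → G'}

/-- Elements of one row divide each other on the right, and right multiplication does not change the
row. -/
theorem row_map_eq (Ψ : ReesMatrix A →ₙ* ReesMatrix A') {x y : ReesMatrix A}
    (h : x.row = y.row) : (Ψ x).row = (Ψ y).row := by
  have hx : x = y * ⟨x.row, (A y.col x.row)⁻¹ * y.val⁻¹ * x.val, x.col⟩ := by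
    ext
    · exact h
    · simp [mul_assoc]
    · rfl
  rw [hx, map_mul, mul_row]

theorem col_map_eq (Ψ : ReesMatrix A →ₙ* ReesMatrix A') {x y : ReesMatrix A}
    (h : x.col = y.col) : (Ψ x).col = (Ψ y).col := by
  have hx : x = ⟨x.row, x.val * y.val⁻¹ * (A x.col y.row)⁻¹, x.col⟩ * y := by
    ext
    · rfl
    · simp [mul_assoc]
    · exact h
  rw [hx, map_mul, mul_col]

/-- Isomorphic matrix semigroups have equivalent matrices. -/
theorem exists_equivalence_of_equiv (Ψ : ReesMatrix A ≃* ReesMatrix A')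
    [Nonempty I] [Nonempty Λ] :
    ∃ (σ : I ≃ I') (τ : Λ ≃ Λ') (φ : G ≃* G') (u : I → G') (v : Λ → G'),
      ∀ l i, φ (A l i) = v l * A' (τ l) (σ i) * u i := by
  obtain ⟨i₀⟩ := ‹Nonempty I›
  obtain ⟨l₀⟩ := ‹Nonempty Λ›
  have hrow : ∀ {x y : ReesMatrix A}, x.row = y.row → (Ψ x).row = (Ψ y).row :=
    fun h => row_map_eq (Ψ : ReesMatrix A →ₙ* ReesMatrix A') h
  have hcol : ∀ {x y : ReesMatrix A}, x.col = y.col → (Ψ x).col = (Ψ y).col :=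
    fun h => col_map_eq (Ψ : ReesMatrix A →ₙ* ReesMatrix A') h
  have hrow' : ∀ {x y : ReesMatrix A'}, x.row = y.row → (Ψ.symm x).row = (Ψ.symm y).row :=
    fun h => row_map_eq (Ψ.symm : ReesMatrix A' →ₙ* ReesMatrix A) h
  have hcol' : ∀ {x y : ReesMatrix A'}, x.col = y.col → (Ψ.symm x).col = (Ψ.symm y).col :=
    fun h => col_map_eq (Ψ.symm : ReesMatrix A' →ₙ* ReesMatrix A) h
  set z := Ψ ⟨i₀, 1, l₀⟩ with hz
  let σ : I ≃ I' :=
    { toFun := fun i => (Ψ ⟨i, 1, l₀⟩).row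
      invFun := fun j => (Ψ.symm ⟨j, 1, z.col⟩).row
      left_inv := fun i => by
        have h := hrow' (x := ⟨(Ψ ⟨i, 1, l₀⟩).row, 1, z.col⟩) (y := Ψ ⟨i, 1, l₀⟩) rfl
        exact h.trans (congrArg row (Ψ.symm_apply_apply _))
      right_inv := fun j => by
        have h := hrow (x := ⟨(Ψ.symm ⟨j, 1, z.col⟩).row, 1, l₀⟩) (y := Ψ.symm ⟨j, 1, z.col⟩) rfl
        exact h.trans (congrArg row (Ψ.apply_symm_apply _)) }
  let τ : Λ ≃ Λ' :=
    { toFun := fun l => (Ψ ⟨i₀, 1, l⟩).col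
      invFun := fun m => (Ψ.symm ⟨z.row, 1, m⟩).col
      left_inv := fun l => by
        have h := hcol' (x := ⟨z.row, 1, (Ψ ⟨i₀, 1, l⟩).col⟩) (y := Ψ ⟨i₀, 1, l⟩) rfl
        exact h.trans (congrArg col (Ψ.symm_apply_apply _))
      right_inv := fun m => by
        have h := hcol (x := ⟨i₀, 1, (Ψ.symm ⟨z.row, 1, m⟩).col⟩)
          (y := Ψ.symm ⟨z.row, 1, m⟩) rfl
        exact h.trans (congrArg col (Ψ.apply_symm_apply _)) }
  have hσ : ∀ x, (Ψ x).row = σ x.row := fun x => hrow rfl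
  have hτ : ∀ x, (Ψ x).col = τ x.col := fun x => hcol rfl
  -- The cell at (i₀, l₀) is a copy of G through g ↦ (i₀, a⁻¹ g, l₀), because (a⁻¹ g) a (a⁻¹ h) =
  -- a⁻¹ g h. The isomorphism φ is Ψ on this cell, the target being read through g' ↦ g' a'⁻¹.
  let a := A l₀ i₀
  let a' := A' (τ l₀) (σ i₀)
  have hval : ∀ x y, (Ψ (x * y)).val = (Ψ x).val * A' (τ x.col) (σ y.row) * (Ψ y).val := by
    intro x y
    rw [map_mul, mul_val, hσ, hτ]
  let φ : G ≃* G' :=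
    { toFun := fun g => (Ψ ⟨i₀, a⁻¹ * g, l₀⟩).val * a'
      invFun := fun g' => a * (Ψ.symm ⟨σ i₀, g' * a'⁻¹, τ l₀⟩).val
      left_inv := fun g => by
        have h : (⟨σ i₀, (Ψ ⟨i₀, a⁻¹ * g, l₀⟩).val * a' * a'⁻¹, τ l₀⟩ : ReesMatrix A') =
            Ψ ⟨i₀, a⁻¹ * g, l₀⟩ := by
          ext
          · rw [hσ]
          · simp
          · rw [hτ]
        change a * (Ψ.symm ⟨σ i₀, (Ψ ⟨i₀, a⁻¹ * g, l₀⟩).val * a' * a'⁻¹, τ l₀⟩).val = g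
        rw [h, Ψ.symm_apply_apply, mul_inv_cancel_left]
      right_inv := fun g' => by
        have h : (⟨i₀, a⁻¹ * (a * (Ψ.symm ⟨σ i₀, g' * a'⁻¹, τ l₀⟩).val), l₀⟩ : ReesMatrix A) =
            Ψ.symm ⟨σ i₀, g' * a'⁻¹, τ l₀⟩ := by
          ext
          · exact σ.injective (by rw [← hσ (Ψ.symm _), Ψ.apply_symm_apply])
          · simp
          · exact τ.injective (by rw [← hτ (Ψ.symm _), Ψ.apply_symm_apply])
        change (Ψ ⟨i₀, a⁻¹ * (a * (Ψ.symm ⟨σ i₀, g' * a'⁻¹, τ l₀⟩).val), l₀⟩).val * a' = g'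
        rw [h, Ψ.apply_symm_apply, inv_mul_cancel_right]
      map_mul' := fun g h => by
        have hgh : (⟨i₀, a⁻¹ * (g * h), l₀⟩ : ReesMatrix A) =
            ⟨i₀, a⁻¹ * g, l₀⟩ * ⟨i₀, a⁻¹ * h, l₀⟩ := by
          ext
          · rfl
          · change _ = a⁻¹ * g * a * (a⁻¹ * h)
            simp [mul_assoc]
          · rfl
        rw [hgh, hval, mul_assoc] }
  refine ⟨σ, τ, φ, fun i => (Ψ ⟨i, 1, l₀⟩).val * a',
    fun l => (φ a)⁻¹ * (Ψ ⟨i₀, 1, l⟩).val, fun l i => ?_⟩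
  -- The product (i₀, 1, l)(i, 1, l₀) has value A l i; its image under Ψ contains the entry of A',
  -- and the remaining factors are u and v.
  have h1 : (⟨i₀, a⁻¹ * (a * A l i), l₀⟩ : ReesMatrix A) = ⟨i₀, 1, l⟩ * ⟨i, 1, l₀⟩ := by
    ext
    · rfl
    · simp
    · rfl
  have h2 : φ (a * A l i) = (Ψ (⟨i₀, 1, l⟩ * ⟨i, 1, l₀⟩)).val * a' := by
    rw [← h1]
    rfl
  rw [map_mul, hval] at h2
  rw [eq_comm, mul_assoc, mul_assoc, inv_mul_eq_iff_eq_mul, h2]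
  simp only [mul_assoc]

end

/-! ### The matrix form of a semigroup with a minimal idempotent -/

section
variable {S G : Type*} [Semigroup S] [Group G]

/-- The idempotents in the left ideal `S e` of a minimal idempotent `e`. -/
abbrev LeftIdem (e : S) : Type _ := {p : S // p * e = p ∧ e * p = e}

/-- The idempotents in the right ideal `e S` of a minimal idempotent `e`. -/
abbrev RightIdem (e : S) : Type _ := {q : S // e * q = q ∧ q * e = e}

/-- `γ` identifies `G` with the group `e S e`, where `e = γ 1`, and `S = S e S`. -/
structure IsSandwichGroup (γ : G →ₙ* S) : Prop where
  injective : Function.Injective γ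
  corner : ∀ s, ∃ g, γ 1 * s * γ 1 = γ g
  simple : ∀ s, ∃ a b, s = a * γ 1 * b

/-- Rees coordinates normalised at e = γ 1: an element is p g q, where g is its corner in eSe and p,
q are idempotents of Se and eS. Multiplying two such elements produces the entry qp, which lies in
eSe. -/
theorem IsSandwichGroup.exists_equiv {γ : G →ₙ* S} (hγ : IsSandwichGroup γ) :
    ∃ A : RightIdem (γ 1) → LeftIdem (γ 1) → G,
      (∀ q p, γ (A q p) = q.1 * p.1) ∧ Nonempty (ReesMatrix A ≃* S) := by
  have hA : ∀ (q : RightIdem (γ 1)) (p : LeftIdem (γ 1)), ∃ g, γ g = q.1 * p.1 := by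
    intro q p
    obtain ⟨g, hg⟩ := hγ.corner (q.1 * p.1)
    refine ⟨g, ?_⟩
    rw [← hg, ← mul_assoc, q.2.1, mul_assoc, p.2.1]
  choose A hA using hA
  have hl : ∀ g, γ 1 * γ g = γ g := fun g => by rw [← map_mul, one_mul]
  have hr : ∀ g, γ g * γ 1 = γ g := fun g => by rw [← map_mul, mul_one]
  let f : ReesMatrix A →ₙ* S :=
    { toFun := fun x => x.row.1 * γ x.val * x.col.1
      map_mul' := fun x y => by simp only [mul_row, mul_val, mul_col, map_mul, hA, mul_assoc] }
  have hfe : ∀ x, f x * γ 1 = x.row.1 * γ x.val := fun x => by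
    change x.row.1 * γ x.val * x.col.1 * γ 1 = _
    rw [mul_assoc, x.col.2.2, mul_assoc, hr]
  have hef : ∀ x, γ 1 * f x = γ x.val * x.col.1 := fun x => by
    change γ 1 * (x.row.1 * γ x.val * x.col.1) = _
    rw [← mul_assoc, ← mul_assoc, x.row.2.2, hl]
  have hinj : Function.Injective f := by
    intro x y hxy
    have h1 : x.row.1 * γ x.val = y.row.1 * γ y.val := by rw [← hfe, ← hfe, hxy]
    have h2 : γ x.val * x.col.1 = γ y.val * y.col.1 := by rw [← hef, ← hef, hxy]
    have h3 : x.val = y.val := by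
      apply hγ.injective
      have h := congrArg (γ 1 * ·) h1
      simpa only [← mul_assoc, x.row.2.2, y.row.2.2, hl] using h
    rw [h3] at h1 h2
    ext
    · have h := congrArg (· * γ y.val⁻¹) h1
      simpa only [mul_assoc, ← map_mul, mul_inv_cancel, x.row.2.1, y.row.2.1] using h
    · exact h3
    · have h := congrArg (γ y.val⁻¹ * ·) h2
      simpa only [← mul_assoc, ← map_mul, inv_mul_cancel, x.col.2.1, y.col.2.1] using h
  have hsurj : Function.Surjective f := by
    intro s
    obtain ⟨a, b, rfl⟩ := hγ.simple s
    obtain ⟨g, hg⟩ := hγ.corner a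
    obtain ⟨h, hh⟩ := hγ.corner b
    -- For s = a e b with corners g of a and h of b, the idempotents are a g⁻¹ and h⁻¹ b.
    refine ⟨⟨⟨a * γ g⁻¹, ?_, ?_⟩, g * h, ⟨γ h⁻¹ * b, ?_, ?_⟩⟩, ?_⟩
    · rw [mul_assoc, hr]
    · rw [← hl g⁻¹, ← mul_assoc, ← mul_assoc, hg, ← map_mul, mul_inv_cancel]
    · rw [← mul_assoc, hl]
    · rw [← hr h⁻¹, mul_assoc, mul_assoc, ← mul_assoc (γ 1), hh, ← map_mul, inv_mul_cancel]
    · change a * γ g⁻¹ * γ (g * h) * (γ h⁻¹ * b) = a * γ 1 * b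
      have h4 : γ g⁻¹ * γ (g * h) * γ h⁻¹ = γ 1 := by
        rw [← map_mul, ← map_mul]
        congr 1
        group
      rw [← h4]
      simp only [mul_assoc]
  exact ⟨A, hA, ⟨MulEquiv.ofBijective f ⟨hinj, hsurj⟩⟩⟩

end

end ReesMatrix

/-! ### Minimal idempotents of the Ellis semigroup -/

section EllisSemigroup

variable {T : Type w} [CommGroup T] {X : Type u} [TopologicalSpace X] [MulAction T X]
  [ContinuousConstSMul T X]

theorem ellis_mul_apply (f g : ellis T X) (x : X) : (f * g).1 x = f.1 (g.1 x) := rfl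

theorem ellis_mem_of_isClosed {P : Set (X → X)} (hP : IsClosed P)
    (h : ∀ t : T, (fun x => t • x) ∈ P) (f : ellis T X) : f.1 ∈ P :=
  closure_minimal (by rintro _ ⟨t, rfl⟩; exact h t) hP f.2

theorem IsMinimalIdempotent.apply_apply {e : ellis T X} (he : IsMinimalIdempotent e) (x : X) :
    e.1 (e.1 x) = e.1 x :=
  congrFun (congrArg Subtype.val he.1.eq) x

theorem IsMinimalIdempotent.apply_eRange {e : ellis T X} (he : IsMinimalIdempotent e)
    (x : eRange e) : e.1 x = x := by
  obtain ⟨_, y, rfl⟩ := x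
  exact he.apply_apply y

/-- The map `x ↦ g (e x)` of `X` that belongs to a permutation `g` of `e X`. -/
def liftPerm (e : ellis T X) (g : Equiv.Perm (eRange e)) : X → X :=
  fun x => g ⟨e.1 x, mem_range_self x⟩

theorem liftPerm_mem_ellisSet {e : ellis T X} (he : IsMinimalIdempotent e)
    {g : Equiv.Perm (eRange e)} (hg : g ∈ structureGroup e he) : liftPerm e g ∈ ellisSet T X := by
  obtain ⟨⟨f, hf⟩, -⟩ := hg
  have h : liftPerm e g = (e * f * e * e).1 := funext fun x => hf _
  rw [h]
  exact (e * f * e * e).2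

variable [CompactSpace X] [T2Space X]

/-- The left ideal of a minimal idempotent is minimal. -/
theorem IsMinimalIdempotent.exists_left_inverse {e : ellis T X} (he : IsMinimalIdempotent e)
    (f : ellis T X) : ∃ g : ellis T X, g * f * e = e := by
  let : TopologicalSpace (Function.End X) := Pi.topologicalSpace
  have : T2Space (Function.End X) := inferInstanceAs (T2Space (X → X))
  have hmul : ∀ r : Function.End X, Continuous (· * r) := fun r =>
    continuous_pi fun x => continuous_apply (A := fun _ : X => X) (r x)
  have hcpt : IsCompact (ellis T X : Set (Function.End X)) :=
    (isClosed_closure (X := X → X)).isCompact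
  -- Ellis–Numakura in the compact left ideal E f e gives an idempotent p = g f e there. Then e p is
  -- an idempotent below e, hence equal to e.
  obtain ⟨_, ⟨g, hg, rfl⟩, hidem⟩ := exists_idempotent_in_compact_subsemigroup hmul
    ((· * (f * e).1) '' (ellis T X : Set (Function.End X)))
    ⟨_, 1, one_mem _, rfl⟩ (hcpt.image (hmul _)) (by
      rintro _ ⟨g, hg, rfl⟩ _ ⟨k, hk, rfl⟩
      exact ⟨g * (f * e).1 * k, mul_mem (mul_mem hg (f * e).2) hk, by simp only [mul_assoc]⟩)
  let p : ellis T X := ⟨g, hg⟩ * (f * e)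
  have hp : p * p = p := Subtype.ext hidem
  have hpe : p * e = p := by simp only [p, mul_assoc, he.1.eq]
  have h : e * p = e := he.2 (e * p)
    (by rw [IsIdempotentElem, mul_assoc, ← mul_assoc p, hpe, hp])
    (by rw [← mul_assoc, he.1.eq]) (by rw [mul_assoc, hpe])
  exact ⟨e * ⟨g, hg⟩, by simpa only [p, mul_assoc] using h⟩

/-- `e E e` is a group. -/
theorem IsMinimalIdempotent.exists_inverse {e : ellis T X} (he : IsMinimalIdempotent e)
    (f : ellis T X) : ∃ g : ellis T X, (e * g * e) * (e * f * e) = e ∧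
      (e * f * e) * (e * g * e) = e := by
  have hl : ∀ f : ellis T X, ∃ g : ellis T X, (e * g * e) * (e * f * e) = e := by
    intro f
    obtain ⟨g, hg⟩ := he.exists_left_inverse (e * f)
    refine ⟨g * e, ?_⟩
    have h : (e * (g * e) * e) * (e * f * e) = e * (g * (e * e * e * f) * e) := by
      simp only [mul_assoc]
    rw [h]
    simp only [he.1.eq]
    rw [hg, he.1.eq]
  obtain ⟨g, hg⟩ := hl f
  obtain ⟨k, hk⟩ := hl g
  refine ⟨g, hg, ?_⟩
  have hee : ∀ f : ellis T X, e * (e * f * e) = e * f * e := fun f => by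
    simp only [← mul_assoc, he.1.eq]
  have hee' : ∀ f : ellis T X, (e * f * e) * e = e * f * e := fun f => by
    simp only [mul_assoc, he.1.eq]
  have h : e * k * e = e * f * e :=
    calc e * k * e = e * k * e * (e * g * e * (e * f * e)) := by rw [hg, hee']
      _ = e * (e * f * e) := by rw [← mul_assoc, hk]
      _ = e * f * e := hee f
  rw [← h, hk]

/-- E e E is an ideal, and every ideal contains e since g j e = e for any j in it and a suitable g.
-/
theorem IsMinimalIdempotent.mem_kernel_iff {e : ellis T X} (he : IsMinimalIdempotent e)
    {f : Function.End X} :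
    f ∈ ellisKernel T X ↔ ∃ a b : ellis T X, f = (a * e * b).1 := by
  constructor
  · intro hf
    refine hf.2 {f | ∃ a b : ellis T X, f = (a * e * b).1} ⟨?_, ⟨_, 1, 1, rfl⟩, ?_, ?_⟩
    · rintro _ ⟨a, b, rfl⟩
      exact (a * e * b).2
    · rintro f hf _ ⟨a, b, rfl⟩
      exact ⟨⟨f, hf⟩ * a, b, by simp only [mul_assoc]; rfl⟩
    · rintro f hf _ ⟨a, b, rfl⟩
      exact ⟨a, b * ⟨f, hf⟩, by simp only [← mul_assoc]; rfl⟩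
  · rintro ⟨a, b, rfl⟩
    refine ⟨(a * e * b).2, fun J hJ => ?_⟩
    have he' : e.1 ∈ J := by
      obtain ⟨j, hj⟩ := hJ.nonempty
      obtain ⟨g, hg⟩ := he.exists_left_inverse ⟨j, hJ.subset hj⟩
      rw [← hg]
      exact hJ.mul_mem_right _ e.2 _ (hJ.mul_mem_left _ g.2 _ hj)
    exact hJ.mul_mem_right _ b.2 _ (hJ.mul_mem_left _ a.2 _ he')

/-- Every element of `e E e` restricts to a permutation of `e X`. -/
theorem exists_mem_structureGroup {e : ellis T X} (he : IsMinimalIdempotent e)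
    (f : ellis T X) : ∃ g ∈ structureGroup e he, ∀ x, (g x : X) = e.1 (f.1 x) := by
  obtain ⟨k, h1, h2⟩ := he.exists_inverse f
  have hcancel : ∀ a b : ellis T X, (e * a * e) * (e * b * e) = e →
      ∀ x : eRange e, e.1 (a.1 (e.1 (b.1 x))) = x := by
    intro a b hab x
    have h := congrFun (congrArg Subtype.val hab) x
    change e.1 (a.1 (e.1 (e.1 (b.1 (e.1 x))))) = e.1 x at h
    rwa [he.apply_apply, he.apply_eRange] at h
  have hval : ∀ (a : ellis T X) (x : eRange e), e.1 (a.1 x) = (e * a * e).1 x := fun a x => by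
    rw [ellis_mul_apply, ellis_mul_apply, he.apply_eRange]
  let g : Equiv.Perm (eRange e) :=
    { toFun := fun x => ⟨e.1 (f.1 x), mem_range_self _⟩
      invFun := fun x => ⟨e.1 (k.1 x), mem_range_self _⟩
      left_inv := fun x => Subtype.ext (hcancel k f h1 x)
      right_inv := fun x => Subtype.ext (hcancel f k h2 x) }
  exact ⟨g, ⟨⟨f, fun x => hval f x⟩, ⟨k, fun x => hval k x⟩⟩, fun _ => rfl⟩

/-- Turns membership in 𝒢 into membership in a closed subset of X → X; the condition on the inverse
is automatic because eEe is a group. -/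
theorem mem_structureGroup_of_liftPerm {e : ellis T X} (he : IsMinimalIdempotent e)
    {g : Equiv.Perm (eRange e)} (hg : liftPerm e g ∈ ellisSet T X) : g ∈ structureGroup e he := by
  obtain ⟨g', hg', h⟩ := exists_mem_structureGroup he ⟨liftPerm e g, hg⟩
  have : g = g' := by
    refine Equiv.ext fun x => Subtype.ext ?_
    rw [h]
    change _ = e.1 (g ⟨e.1 x, _⟩)
    rw [he.apply_eRange]
    congr 2
    exact Subtype.ext (he.apply_eRange x).symm
  rwa [this]

/-- The structure group is closed for pointwise convergence. -/
theorem mem_structureGroup_of_mem_closure {e : ellis T X} (he : IsMinimalIdempotent e)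
    {g : Equiv.Perm (eRange e)}
    (hg : liftPerm e g ∈ closure (liftPerm e '' (structureGroup e he : Set _))) :
    g ∈ structureGroup e he := by
  refine mem_structureGroup_of_liftPerm he ?_
  refine closure_minimal ?_ isClosed_closure hg
  rintro _ ⟨k, hk, rfl⟩
  exact liftPerm_mem_ellisSet he hk

end EllisSemigroup

/-! ### Group factors -/

section GroupFactor

variable {T : Type w} [CommGroup T] {X Z : Type u} [TopologicalSpace X] [MulAction T X]
  [ContinuousConstSMul T X] [AddCommGroup Z] {π : X → Z}

/-- A factor map onto a topological group on which `T` acts by translations. -/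
structure IsGroupFactor (T : Type w) [CommGroup T] {X Z : Type u} [TopologicalSpace X]
    [MulAction T X] [AddCommGroup Z] [TopologicalSpace Z] [MulAction T Z] (π : X → Z) : Prop where
  isFactorMap : IsFactorMap T π
  smul_eq : ∀ (t : T) (z : Z), t • z = z + t • (0 : Z)

section Shifts

variable [TopologicalSpace Z] [MulAction T Z]

theorem IsGroupFactor.map_smul (hπ : IsGroupFactor T π) (t : T) (x : X) :
    π (t • x) = π x + t • (0 : Z) := by
  rw [hπ.isFactorMap.map_smul, hπ.smul_eq]

theorem IsGroupFactor.nonempty (hπ : IsGroupFactor T π) : Nonempty X :=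
  let ⟨x, _⟩ := hπ.isFactorMap.surjective 0
  ⟨x⟩

variable [IsTopologicalAddGroup Z] [T2Space Z]

/-- Elements of the Ellis semigroup induce translations on a group factor. -/
theorem IsGroupFactor.ellis_shift (hπ : IsGroupFactor T π) (f : ellis T X) :
    ∃ ξ, ∀ x, π (f.1 x) = π x + ξ := by
  have hc := hπ.isFactorMap.continuous
  -- This is a closed condition on k, satisfied by T because T acts by translations on the factor.
  have h : f.1 ∈ {k : X → X | ∀ x y, π (k x) - π x = π (k y) - π y} := by
    refine ellis_mem_of_isClosed ?_ (fun t x y => ?_) f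
    · simp only [ofPred_forall]
      refine isClosed_iInter fun x => isClosed_iInter fun y => isClosed_eq ?_ ?_
      · exact (hc.comp (continuous_apply x)).sub continuous_const
      · exact (hc.comp (continuous_apply y)).sub continuous_const
    · rw [hπ.map_smul, hπ.map_smul, add_sub_cancel_left, add_sub_cancel_left]
  obtain ⟨x₀⟩ := hπ.nonempty
  exact ⟨π (f.1 x₀) - π x₀, fun x => by rw [← h x x₀, add_sub_cancel]⟩

/-- Idempotents of the Ellis semigroup preserve the fibres of a group factor. -/
theorem IsGroupFactor.idempotent_apply (hπ : IsGroupFactor T π) {p : ellis T X}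
    (hp : IsIdempotentElem p) (x : X) : π (p.1 x) = π x := by
  obtain ⟨ξ, hξ⟩ := hπ.ellis_shift p
  have h : π (p.1 (p.1 x)) = π (p.1 x) := congrArg π (congrFun (congrArg Subtype.val hp.eq) x)
  rw [hξ, add_eq_left] at h
  rw [hξ, h, add_zero]

/-- Automorphisms of a minimal system induce translations on a group factor. -/
theorem IsGroupFactor.aut_shift [MulAction.IsMinimal T X] (hπ : IsGroupFactor T π)
    (α : autGroup T X) : ∃ ξ, ∀ x, π (α.1 x) = π x + ξ := by
  have hc := hπ.isFactorMap.continuous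
  obtain ⟨x₀⟩ := hπ.nonempty
  have h : (fun x => π (α.1 x) - π x) = fun _ => π (α.1 x₀) - π x₀ := by
    refine Continuous.ext_on (MulAction.dense_orbit T x₀) ?_ continuous_const ?_
    · exact (hc.comp α.1.continuous).sub hc
    · rintro _ ⟨t, rfl⟩
      change π (α.1 (t • x₀)) - π (t • x₀) = _
      rw [α.2, hπ.map_smul, hπ.map_smul, add_sub_add_right_eq_sub]
  exact ⟨π (α.1 x₀) - π x₀, fun x => by rw [← congrFun h x, add_sub_cancel]⟩

end Shifts

variable (T π) in
/-- The translations of a group factor that are induced by automorphisms. -/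
def autShifts : AddSubgroup Z where
  carrier := {ξ | ∃ α : autGroup T X, ∀ x, π (α.1 x) = π x + ξ}
  zero_mem' := ⟨1, fun _ => (add_zero _).symm⟩
  add_mem' := by
    rintro ξ ζ ⟨α, hα⟩ ⟨β, hβ⟩
    refine ⟨β * α, fun x => ?_⟩
    change π (β.1 (α.1 x)) = _
    rw [hβ, hα, add_assoc]
  neg_mem' := by
    rintro ξ ⟨α, hα⟩
    refine ⟨α⁻¹, fun x => ?_⟩
    have h := hα (α.1.symm x)
    rw [Homeomorph.apply_symm_apply] at h
    rw [h, add_neg_cancel_right]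
    rfl

theorem IsGroupFactor.autEqOrbit_eq [TopologicalSpace Z] [MulAction T Z]
    [IsTopologicalAddGroup Z] [T2Space Z] [MulAction.IsMinimal T X] (hπ : IsGroupFactor T π) :
    autEqOrbit T π 0 = autShifts T π := by
  ext ξ
  constructor
  · rintro ⟨α, hα, x, hx, hαx⟩
    obtain ⟨ζ, hζ⟩ := hπ.aut_shift ⟨α, hα⟩
    have h := hζ x
    rw [hx, zero_add] at h
    rw [← hαx, show π (α x) = ζ from h]
    exact ⟨⟨α, hα⟩, hζ⟩
  · rintro ⟨α, hα⟩
    obtain ⟨x, hx⟩ := hπ.isFactorMap.surjective 0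
    exact ⟨α.1, α.2, x, hx, by rw [hα, hx, zero_add]⟩

/-- An idempotent of the Ellis semigroup moves points only to proximal points. -/
theorem proximal_idempotent_apply [CompactSpace X] [T2Space X] {p : ellis T X}
    (hp : IsIdempotentElem p) (x : X) : Proximal T (p.1 x) x := by
  intro U hU
  let p' : X → X := p.1
  have hpp : p' (p' x) = p' x := congrFun (congrArg Subtype.val hp.eq) x
  have hc : Continuous fun k : X → X => (k (p' x), k x) :=
    (continuous_apply _).prodMk (continuous_apply _)
  have hmem : p' ∈ closure (range fun (t : T) (x : X) => t • x) := p.2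
  -- Both p x and x are sent to p x, so any t close to p at these two points brings them together.
  have hU' : (fun k : X → X => (k (p' x), k x)) ⁻¹' U ∈ 𝓝 p' := by
    refine hc.continuousAt.preimage_mem_nhds ?_
    rw [hpp]
    exact nhds_le_nhdsSet (mem_diagonal (p' x)) hU
  obtain ⟨_, hk, t, rfl⟩ := mem_closure_iff_nhds.1 hmem _ hU'
  exact ⟨t, hk⟩

/-- Idempotents fix the points of the regular fibres. -/
theorem IsGroupFactor.idempotent_apply_eq [TopologicalSpace Z] [MulAction T Z]
    [IsTopologicalAddGroup Z] [T2Space Z] [CompactSpace X] [T2Space X] [MulAction.IsMinimal T X]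
    (hπ : IsGroupFactor T π) (hU : IsUSF T π) {p : ellis T X} (hp : IsIdempotentElem p) {x : X}
    (hx : π x ∉ autShifts T π) : p.1 x = x := by
  by_contra hne
  refine hx ?_
  have h : π x ∈ singularPoints T π :=
    ⟨p.1 x, x, hπ.idempotent_apply hp x, rfl, hne, proximal_idempotent_apply hp x⟩
  rwa [show singularPoints T π = autEqOrbit T π 0 from hU, hπ.autEqOrbit_eq] at h

/-- Any two points of a minimal system are related by an element of the Ellis semigroup. -/
theorem exists_ellis_apply_eq [CompactSpace X] [T2Space X] [MulAction.IsMinimal T X] (x y : X) :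
    ∃ f : ellis T X, f.1 x = y := by
  have hcpt : IsCompact (ellisSet T X) := isClosed_closure.isCompact
  have hcl : IsClosed ((fun k : X → X => k x) '' ellisSet T X) :=
    (hcpt.image (continuous_apply x)).isClosed
  have h := closure_minimal (s := MulAction.orbit T x) (by
    rintro _ ⟨t, rfl⟩
    exact ⟨fun z => t • z, subset_closure ⟨t, rfl⟩, rfl⟩) hcl
  rw [(MulAction.dense_orbit T x).closure_eq] at h
  obtain ⟨f, hf, hfx⟩ := h (mem_univ y)
  exact ⟨⟨f, hf⟩, hfx⟩

/-- An automorphism of a minimal system with a fixed point is trivial. -/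
theorem aut_eq_one_of_fixed [T2Space X] [MulAction.IsMinimal T X] {α : autGroup T X} {x : X}
    (hx : α.1 x = x) (y : X) : α.1 y = y := by
  have h : (α.1 : X → X) = id := by
    refine Continuous.ext_on (MulAction.dense_orbit T x) α.1.continuous continuous_id ?_
    rintro _ ⟨t, rfl⟩
    change α.1 (t • x) = t • x
    rw [α.2, hx]
  exact congrFun h y

end GroupFactor

/-! ### Covariant permutations -/

theorem perm_apply_inv {S : Type*} (g : Equiv.Perm S) (x : S) : g (g⁻¹ x) = x :=
  g.apply_symm_apply x

theorem perm_inv_apply {S : Type*} (g : Equiv.Perm S) (x : S) : g⁻¹ (g x) = x :=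
  g.symm_apply_apply x

section Covariant

variable {T : Type w} [CommGroup T] {X Z : Type u} [TopologicalSpace X] [CompactSpace X]
  [T2Space X] [MulAction T X] [ContinuousConstSMul T X] [AddCommGroup Z] {π : X → Z}
  {e : ellis T X}

theorem autRestrict_apply_inv_self (α : autGroup T X) (x : eRange e) :
    autRestrict e α (autRestrict e α⁻¹ x) = x :=
  Subtype.ext (α.1.apply_symm_apply x)

theorem covariantGroup_apply_comm {g : Equiv.Perm (eRange e)} (hg : g ∈ covariantGroup π e)
    (α : autGroup T X) (x : eRange e) : g (autRestrict e α x) = autRestrict e α (g x) :=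
  (Equiv.congr_fun (hg.2 α) x).symm

variable (π e) in
/-- The covariant permutations that preserve the fibres. -/
def covariantFib : Subgroup (Equiv.Perm (eRange e)) where
  carrier := {g | g ∈ covariantGroup π e ∧ ∀ x, π (g x) = π x}
  one_mem' := ⟨one_mem _, fun _ => rfl⟩
  mul_mem' := fun {_ k} hg hk => ⟨mul_mem hg.1 hk.1, fun x => (hg.2 (k x)).trans (hk.2 x)⟩
  inv_mem' := fun {g} hg => ⟨inv_mem hg.1, fun x => by
    rw [← hg.2 (g⁻¹ x), perm_apply_inv]⟩

theorem mem_covariantFib_of_comm {g : Equiv.Perm (eRange e)} (h : ∀ x, π (g x) = π x)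
    (hc : ∀ (α : autGroup T X) (x : eRange e), g (autRestrict e α x) = autRestrict e α (g x)) :
    g ∈ covariantFib π e :=
  ⟨⟨⟨0, fun x => by rw [h, add_zero]⟩, fun α => Equiv.ext fun x => (hc α x).symm⟩, h⟩

variable (π e) in
/-- The permutations of `e X` that are the identity on the regular fibres. -/
def regularFixing : Subgroup (Equiv.Perm (eRange e)) where
  carrier := {g | ∀ x : eRange e, π x ∉ autShifts T π → g x = x}
  one_mem' := fun _ _ => rfl
  mul_mem' := fun {g k} hg hk x hx => by rw [Equiv.Perm.mul_apply, hk x hx, hg x hx]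
  inv_mem' := fun {g} hg x hx => by rw [Equiv.Perm.inv_eq_iff_eq, hg x hx]

variable [MulAction.IsMinimal T X] [TopologicalSpace Z] [IsTopologicalAddGroup Z] [T2Space Z]
  [MulAction T Z]

theorem IsGroupFactor.mem_eFibre_iff (hπ : IsGroupFactor T π) (he : IsMinimalIdempotent e)
    {x : X} : x ∈ eFibre π e ↔ x ∈ eRange e ∧ π x = 0 := by
  constructor
  · rintro ⟨y, hy, rfl⟩
    exact ⟨mem_range_self y, (hπ.idempotent_apply he.1 y).trans hy⟩
  · rintro ⟨h1, h2⟩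
    exact ⟨x, h2, he.apply_eRange ⟨x, h1⟩⟩

theorem IsGroupFactor.map_eFibre (hπ : IsGroupFactor T π) (he : IsMinimalIdempotent e)
    (y : eFibre π e) : π y = 0 :=
  ((hπ.mem_eFibre_iff he).1 y.2).2

/-- The points over the orbit of `η` are the images of the points over `η` under
automorphisms. -/
theorem exists_autRestrict_eq {η : Z} {x : eRange e}
    (hx : π x - η ∈ autShifts T π) :
    ∃ (α : autGroup T X) (y : eRange e), π y = η ∧ x = autRestrict e α y := by
  obtain ⟨α, hα⟩ := hx
  refine ⟨α, autRestrict e α⁻¹ x, ?_, (autRestrict_apply_inv_self α x).symm⟩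
  have h : π x = π (autRestrict e α⁻¹ x) + (π x - η) := by
    rw [← hα]
    exact congrArg (fun z : eRange e => π z) (autRestrict_apply_inv_self α x).symm
  rw [← sub_eq_iff_eq_add, sub_sub_cancel] at h
  exact h.symm

theorem IsGroupFactor.exists_autRestrict_inclusion_eq (hπ : IsGroupFactor T π)
    (he : IsMinimalIdempotent e) {x : eRange e} (hx : π x ∈ autShifts T π) :
    ∃ (α : autGroup T X) (y : eFibre π e),
      x = autRestrict e α (inclusion (eFibre_subset π e) y) := by
  rw [← sub_zero (π x)] at hx
  obtain ⟨α, y, hy, rfl⟩ := exists_autRestrict_eq hx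
  exact ⟨α, ⟨y, (hπ.mem_eFibre_iff he).2 ⟨y.2, hy⟩⟩, rfl⟩

theorem IsGroupFactor.autRestrict_sub_mem (hπ : IsGroupFactor T π) (α : autGroup T X)
    (x : eRange e) : π (autRestrict e α x) - π x ∈ autShifts T π := by
  obtain ⟨ξ, hξ⟩ := hπ.aut_shift α
  refine ⟨α, fun z => ?_⟩
  rw [hξ, show π (autRestrict e α x) = π x + ξ from hξ x, add_sub_cancel_left]

/-- Fibre preserving covariant permutations can be cut off outside the orbit of a fibre. -/
theorem IsGroupFactor.exists_cutoff (hπ : IsGroupFactor T π) {g : Equiv.Perm (eRange e)}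
    (hg : g ∈ covariantFib π e) (η : Z) : ∃ g' ∈ covariantFib π e,
      (∀ x : eRange e, π x - η ∈ autShifts T π → g' x = g x) ∧
      ∀ x : eRange e, π x - η ∉ autShifts T π → g' x = x := by
  classical
  have h : ∀ x : eRange e, π (g x) - η ∈ autShifts T π ↔ π x - η ∈ autShifts T π := fun x => by
    rw [hg.2]
  -- The part of eX over a coset of `autShifts` is invariant under g and under all automorphisms, so
  -- the cut-off remains covariant.
  let g' : Equiv.Perm (eRange e) :=
    Equiv.Perm.ofSubtype (g.subtypePerm (p := fun x : eRange e => π x - η ∈ autShifts T π) h)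
  have h1 : ∀ x : eRange e, π x - η ∈ autShifts T π → g' x = g x := fun x hx =>
    (Equiv.Perm.ofSubtype_apply_of_mem (p := fun x : eRange e => π x - η ∈ autShifts T π) _
      hx).trans rfl
  have h2 : ∀ x : eRange e, π x - η ∉ autShifts T π → g' x = x := fun x hx =>
    Equiv.Perm.ofSubtype_apply_of_not_mem _ hx
  refine ⟨g', mem_covariantFib_of_comm (fun x => ?_) (fun α x => ?_), h1, h2⟩
  · by_cases hx : π x - η ∈ autShifts T π
    · rw [h1 x hx, hg.2]
    · rw [h2 x hx]
  · have hα : π (autRestrict e α x) - η ∈ autShifts T π ↔ π x - η ∈ autShifts T π := by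
      rw [← sub_add_sub_cancel _ (π x) η]
      exact AddSubgroup.add_mem_cancel_left _ (hπ.autRestrict_sub_mem α x)
    by_cases hx : π x - η ∈ autShifts T π
    · rw [h1 x hx, h1 _ (hα.2 hx), covariantGroup_apply_comm hg.1]
    · rw [h2 x hx, h2 _ (mt hα.1 hx)]

theorem IsGroupFactor.structureGroup_le (hπ : IsGroupFactor T π) (he : IsMinimalIdempotent e) :
    structureGroup e he ≤ covariantGroup π e := by
  rintro g ⟨⟨f, hf⟩, -⟩
  refine ⟨?_, fun α => Equiv.ext fun x => Subtype.ext ?_⟩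
  · obtain ⟨ξ, hξ⟩ := hπ.ellis_shift (e * f * e)
    exact ⟨ξ, fun x => by rw [hf, hξ]⟩
  · change α.1 (g x) = g (autRestrict e α x)
    rw [hf, hf, ellis_comm_aut]
    rfl

/-- The structure group contains elements with any given translation. -/
theorem IsGroupFactor.exists_structureGroup_shift (hπ : IsGroupFactor T π)
    (he : IsMinimalIdempotent e) (ξ : Z) :
    ∃ g ∈ structureGroup e he, ∀ x, π (g x) = π x + ξ := by
  obtain ⟨x₀⟩ := hπ.nonempty
  obtain ⟨y, hy⟩ := hπ.isFactorMap.surjective (π x₀ + ξ)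
  obtain ⟨f, hf⟩ := exists_ellis_apply_eq (T := T) x₀ y
  obtain ⟨ζ, hζ⟩ := hπ.ellis_shift f
  have hξ : ζ = ξ := by
    have h := hζ x₀
    rw [hf, hy] at h
    exact (add_left_cancel h).symm
  obtain ⟨g, hg, hgf⟩ := exists_mem_structureGroup he f
  exact ⟨g, hg, fun x => by rw [hgf, hπ.idempotent_apply he.1, hζ, hξ]⟩

/-- The generators are products of two idempotents, each preserving the fibres and, by USF, fixing
all regular points. -/
theorem IsGroupFactor.littleStructureGroup_le (hπ : IsGroupFactor T π) (hU : IsUSF T π)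
    (he : IsMinimalIdempotent e) :
    littleStructureGroup e ≤ structureGroupFib π e he ⊓ regularFixing π e := by
  rw [littleStructureGroup, Subgroup.closure_le]
  rintro g ⟨p, q, ⟨-, hp, -⟩, ⟨-, hq, -⟩, hg⟩
  refine ⟨⟨mem_structureGroup_of_liftPerm he ?_, fun x => ?_⟩, fun x hx => Subtype.ext ?_⟩
  · have h : liftPerm e g = (q * p * e).1 := funext fun x => hg _
    rw [h]
    exact (q * p * e).2
  · rw [hg, ellis_mul_apply, hπ.idempotent_apply hq, hπ.idempotent_apply hp]
  · rw [hg, ellis_mul_apply, hπ.idempotent_apply_eq hU hp hx, hπ.idempotent_apply_eq hU hq hx]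

/-- The elements of the topological normal closure of `Γ₀` are limits of restrictions of elements
of the structure group that are the identity on the regular fibres. -/
theorem IsGroupFactor.topNormalClosure_subset (hπ : IsGroupFactor T π) (hU : IsUSF T π)
    (he : IsMinimalIdempotent e) {h : Equiv.Perm (eFibre π e)}
    (hh : h ∈ topNormalClosure (structureGroupFibZero π e he) (littleStructureGroupZero π e)) :
    (h : eFibre π e → eFibre π e) ∈ closure ((fun k : Equiv.Perm (eFibre π e) => ⇑k) ''
      (restrictPerm (eFibre_subset π e) (structureGroupFib π e he ⊓ regularFixing π e) :
        Set (Equiv.Perm (eFibre π e)))) := by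
  refine closure_mono (image_mono ?_) hh.2
  set N := restrictPerm (eFibre_subset π e) (structureGroupFib π e he ⊓ regularFixing π e)
  set G := structureGroupFibZero π e he
  -- Conjugation by fibre-preserving permutations keeps the regular fibres fixed pointwise; so N is
  -- normal and absorbs the normal closure of Γ₀.
  have hN : (N.subgroupOf G).Normal := by
    refine ⟨fun n hn k => ?_⟩
    obtain ⟨f, hf, hfn⟩ := hn
    obtain ⟨g, hg, hgk⟩ := k.2
    refine ⟨g * f * g⁻¹, ⟨Subgroup.mul_mem _ (Subgroup.mul_mem _ hg hf.1) (Subgroup.inv_mem _ hg), fun x hx => ?_⟩, ?_⟩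
    · have h1 : π (g⁻¹ x) = π x := ((structureGroupFib π e he).inv_mem hg).2 x
      rw [Equiv.Perm.mul_apply, Equiv.Perm.mul_apply, hf.2 _ (by rwa [h1]),
        perm_apply_inv]
    · intro y
      obtain ⟨z, rfl⟩ := k.1.surjective y
      rw [← hgk, Equiv.Perm.mul_apply, perm_inv_apply, Equiv.Perm.mul_apply,
        show f (inclusion _ z) = inclusion (eFibre_subset π e) (n.1 z) from hfn z, hgk]
      congr 1
      change _ = k.1 (n.1 (k.1⁻¹ (k.1 z)))
      rw [perm_inv_apply]
  rintro _ ⟨k, hk, rfl⟩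
  refine Subgroup.normalClosure_le_normal (N := N.subgroupOf G) ?_ hk
  rintro n ⟨f, hf, hfn⟩
  exact ⟨f, hπ.littleStructureGroup_le hU he hf, hfn⟩

/-- Fibre preserving permutations restrict to the fibre of `0`. -/
theorem IsGroupFactor.exists_restrict (hπ : IsGroupFactor T π) (he : IsMinimalIdempotent e)
    {b : Equiv.Perm (eRange e)} (hb : ∀ x, π (b x) = π x) : ∃ h : Equiv.Perm (eFibre π e),
      ∀ y, b (inclusion (eFibre_subset π e) y) = inclusion (eFibre_subset π e) (h y) := by
  have hbY : ∀ y : eFibre π e, (b (inclusion (eFibre_subset π e) y) : X) ∈ eFibre π e := fun y =>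
    (hπ.mem_eFibre_iff he).2 ⟨(b _).2, (hb _).trans (hπ.map_eFibre he y)⟩
  have hb' : ∀ x, π (b⁻¹ x) = π x := fun x => by rw [← hb (b⁻¹ x), perm_apply_inv]
  have hbY' : ∀ y : eFibre π e,
      (b⁻¹ (inclusion (eFibre_subset π e) y) : X) ∈ eFibre π e := fun y =>
    (hπ.mem_eFibre_iff he).2 ⟨(b⁻¹ _).2,
      (hb' _).trans (hπ.map_eFibre he y)⟩
  refine ⟨⟨fun y => ⟨b (inclusion (eFibre_subset π e) y), hbY y⟩,
    fun y => ⟨b⁻¹ (inclusion (eFibre_subset π e) y), hbY' y⟩, fun y => Subtype.ext ?_,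
    fun y => Subtype.ext ?_⟩, fun y => rfl⟩
  · change ((b⁻¹ (b (inclusion (eFibre_subset π e) y)) : eRange e) : X) = y
    rw [perm_inv_apply]
  · change ((b (b⁻¹ (inclusion (eFibre_subset π e) y)) : eRange e) : X) = y
    rw [perm_apply_inv]

/-- If the topological normal closure of `Γ₀` is the full permutation group, then the structure
group contains all fibre preserving covariant permutations that are the identity on the regular
fibres. -/
theorem IsGroupFactor.inf_regularFixing_le_structureGroup (hπ : IsGroupFactor T π)
    (hU : IsUSF T π) (he : IsMinimalIdempotent e)
    (hΓ : ∀ h : Equiv.Perm (eFibre π e),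
      h ∈ topNormalClosure (structureGroupFibZero π e he) (littleStructureGroupZero π e)) :
    covariantFib π e ⊓ regularFixing π e ≤ structureGroup e he := by
  classical
  intro b hb
  obtain ⟨h, hh⟩ := hπ.exists_restrict he hb.1.2
  have hdec : ∀ x : eRange e, ∃ (α : autGroup T X) (y : eFibre π e), π x ∈ autShifts T π →
      x = autRestrict e α (inclusion (eFibre_subset π e) y) := by
    intro x
    by_cases hx : π x ∈ autShifts T π
    · obtain ⟨α, y, hy⟩ := hπ.exists_autRestrict_inclusion_eq he hx
      exact ⟨α, y, fun _ => hy⟩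
    · obtain ⟨z, hz⟩ := hπ.isFactorMap.surjective 0
      exact ⟨1, ⟨e.1 z, z, hz, rfl⟩, fun h => absurd h hx⟩
  choose α y hαy using hdec
  -- Rebuilds the lift of a covariant permutation, trivial on the regular fibres, from its
  -- restriction k to Y. Each value uses k at one point only, followed by a homeomorphism, so Φ is
  -- pointwise continuous.
  let Φ : (eFibre π e → eFibre π e) → X → X := fun k x =>
    if π (e.1 x) ∈ autShifts T π then
      (α ⟨e.1 x, mem_range_self x⟩).1 (k (y ⟨e.1 x, mem_range_self x⟩)) else e.1 x
  have hΦc : Continuous Φ := by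
    refine continuous_pi fun x => ?_
    by_cases hx : π (e.1 x) ∈ autShifts T π
    · simp only [Φ, if_pos hx]
      exact (α _).1.continuous.comp (continuous_subtype_val.comp (continuous_apply _))
    · simp only [Φ, if_neg hx]
      exact continuous_const
  have hΦ : ∀ (k : Equiv.Perm (eFibre π e)) (g : Equiv.Perm (eRange e)),
      g ∈ covariantGroup π e → g ∈ regularFixing π e →
      (∀ z, g (inclusion (eFibre_subset π e) z) = inclusion (eFibre_subset π e) (k z)) →
      Φ k = liftPerm e g := by
    intro k g hg hgr hgk
    funext x
    by_cases hx : π (e.1 x) ∈ autShifts T π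
    · simp only [Φ, if_pos hx, liftPerm]
      conv_rhs => rw [hαy ⟨e.1 x, mem_range_self x⟩ hx, covariantGroup_apply_comm hg, hgk]
      rfl
    · simp only [Φ, if_neg hx, liftPerm]
      exact (congrArg Subtype.val (hgr ⟨e.1 x, mem_range_self x⟩ hx)).symm
  refine mem_structureGroup_of_mem_closure he ?_
  rw [← hΦ h b hb.1.1 hb.2 hh]
  refine map_mem_closure hΦc (hπ.topNormalClosure_subset hU he (hΓ h)) ?_
  rintro _ ⟨k, ⟨g, hg, hgk⟩, rfl⟩
  exact ⟨g, hg.1.1, (hΦ k g (hπ.structureGroup_le he hg.1.1) hg.2 hgk).symm⟩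

end Covariant

/-! ### From one orbit of fibres to the full structure group -/

section StructureGroup

variable {T : Type w} [CommGroup T] {X Z : Type u} [TopologicalSpace X] [CompactSpace X]
  [T2Space X] [MulAction T X] [ContinuousConstSMul T X] [AddCommGroup Z] {π : X → Z}
  {e : ellis T X} [MulAction.IsMinimal T X] [TopologicalSpace Z] [IsTopologicalAddGroup Z]
  [T2Space Z] [MulAction T Z]

/-- The structure group contains the fibre preserving covariant permutations that are supported
over a single orbit of automorphisms. -/
theorem IsGroupFactor.mem_structureGroup_of_support (hπ : IsGroupFactor T π)
    (he : IsMinimalIdempotent e)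
    (hK : covariantFib π e ⊓ regularFixing π e ≤ structureGroup e he)
    {g : Equiv.Perm (eRange e)} (hg : g ∈ covariantFib π e) (η : Z)
    (hη : ∀ x : eRange e, π x - η ∉ autShifts T π → g x = x) : g ∈ structureGroup e he := by
  -- F shifts the fibre of 0 to that of η, so F⁻¹ g F is supported over 𝔞_eq(0).
  obtain ⟨F, hF, hFη⟩ := hπ.exists_structureGroup_shift he η
  have hFc := hπ.structureGroup_le he hF
  have hk : F⁻¹ * g * F ∈ structureGroup e he := by
    refine hK ⟨⟨mul_mem (mul_mem (inv_mem hFc) hg.1) hFc, fun x => ?_⟩, fun x hx => ?_⟩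
    · have h := hFη (F⁻¹ (g (F x)))
      rw [perm_apply_inv, hg.2, hFη] at h
      exact (add_right_cancel h).symm
    · rw [Equiv.Perm.mul_apply, Equiv.Perm.mul_apply, hη, perm_inv_apply]
      rwa [hFη, add_sub_cancel_right]
  have h := mul_mem (mul_mem hF hk) (inv_mem hF)
  rwa [mul_assoc F, mul_inv_cancel_right, mul_inv_cancel_left] at h

/-- The structure group contains all fibre preserving covariant permutations. -/
theorem IsGroupFactor.covariantFib_le_structureGroup (hπ : IsGroupFactor T π)
    (he : IsMinimalIdempotent e)
    (hK : covariantFib π e ⊓ regularFixing π e ≤ structureGroup e he) :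
    covariantFib π e ≤ structureGroup e he := by
  classical
  intro g hg
  have hfin : ∀ s : Finset Z, ∃ n ∈ structureGroup e he, n ∈ covariantFib π e ∧
      ∀ x : eRange e, π x ∈ s → n x = g x := by
    intro s
    induction s using Finset.induction_on with
    | empty => exact ⟨1, one_mem _, one_mem _, fun x hx => absurd hx (Finset.notMem_empty _)⟩
    | insert η s _ ih =>
      obtain ⟨n, hn, hnf, hns⟩ := ih
      -- The correction n⁻¹ g, cut off to the orbit of η, repairs n there. On that orbit n k = g,
      -- elsewhere n k = n, so agreement over s survives even if s meets the orbit.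
      obtain ⟨k, hk, hk1, hk2⟩ := hπ.exists_cutoff (mul_mem (inv_mem hnf) hg) η
      refine ⟨n * k, mul_mem hn (hπ.mem_structureGroup_of_support he hK hk η hk2),
        mul_mem hnf hk, fun x hx => ?_⟩
      rw [Equiv.Perm.mul_apply]
      by_cases hxη : π x - η ∈ autShifts T π
      · rw [hk1 x hxη, Equiv.Perm.mul_apply, perm_apply_inv]
      · rw [hk2 x hxη]
        refine hns x ((Finset.mem_insert.1 hx).resolve_left fun h => hxη ?_)
        rw [h, sub_self]
        exact zero_mem _
  refine mem_structureGroup_of_mem_closure he (mem_closure_iff_nhds.2 fun U hU => ?_)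
  rw [nhds_pi, Filter.mem_pi] at hU
  obtain ⟨I, hI, t, ht, htU⟩ := hU
  -- A basic neighbourhood for pointwise convergence constrains finitely many points, hence finitely
  -- many fibres.
  obtain ⟨n, hn, -, hns⟩ := hfin (hI.toFinset.image fun x => π (e.1 x))
  refine ⟨liftPerm e n, htU fun x hx => ?_, n, hn, rfl⟩
  have h : liftPerm e n x = liftPerm e g x := congrArg Subtype.val (hns ⟨e.1 x, mem_range_self x⟩
    (Finset.mem_image.2 ⟨x, hI.mem_toFinset.2 hx, rfl⟩))
  rw [h]
  exact mem_of_mem_nhds (ht x)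

/-- The structure group consists of all covariant permutations. -/
theorem IsGroupFactor.structureGroup_eq (hπ : IsGroupFactor T π) (hU : IsUSF T π)
    (he : IsMinimalIdempotent e)
    (hΓ : ∀ h : Equiv.Perm (eFibre π e),
      h ∈ topNormalClosure (structureGroupFibZero π e he) (littleStructureGroupZero π e)) :
    structureGroup e he = covariantGroup π e := by
  refine le_antisymm (hπ.structureGroup_le he) fun g hg => ?_
  obtain ⟨ξ, hξ⟩ := hg.1
  obtain ⟨F, hF, hFξ⟩ := hπ.exists_structureGroup_shift he ξ
  have h : g * F⁻¹ ∈ structureGroup e he := by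
    refine hπ.covariantFib_le_structureGroup he
      (hπ.inf_regularFixing_le_structureGroup hU he hΓ)
      ⟨mul_mem hg (inv_mem (hπ.structureGroup_le he hF)), fun x => ?_⟩
    rw [Equiv.Perm.mul_apply, hξ, ← hFξ, perm_apply_inv]
  have h' := mul_mem h hF
  rwa [inv_mul_cancel_right] at h'

theorem IsGroupFactor.covariant_apply_eq (hπ : IsGroupFactor T π) (he : IsMinimalIdempotent e)
    {g k : Equiv.Perm (eRange e)} (hg : g ∈ covariantGroup π e) (hk : k ∈ covariantGroup π e)
    (h : ∀ y, g (inclusion (eFibre_subset π e) y) = k (inclusion (eFibre_subset π e) y))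
    {x : eRange e} (hx : π x ∈ autShifts T π) : g x = k x := by
  obtain ⟨α, y, rfl⟩ := hπ.exists_autRestrict_inclusion_eq he hx
  rw [covariantGroup_apply_comm hg, covariantGroup_apply_comm hk, h]

theorem IsGroupFactor.covariant_ext (hπ : IsGroupFactor T π) (he : IsMinimalIdempotent e)
    {g k : Equiv.Perm (eRange e)} (hg : g ∈ covariantFib π e ⊓ regularFixing π e)
    (hk : k ∈ covariantFib π e ⊓ regularFixing π e)
    (h : ∀ y, g (inclusion (eFibre_subset π e) y) = k (inclusion (eFibre_subset π e) y)) :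
    g = k := by
  refine Equiv.ext fun x => ?_
  by_cases hx : π x ∈ autShifts T π
  · exact hπ.covariant_apply_eq he hg.1.1 hk.1.1 h hx
  · rw [hg.2 x hx, hk.2 x hx]

/-- `E` extends permutations of the fibre of `0` to covariant permutations which are the identity
on the regular fibres. -/
def IsExtensionHom (E : Equiv.Perm (eFibre π e) →* covariantGroup π e) : Prop :=
  ∀ h, (E h).1 ∈ covariantFib π e ⊓ regularFixing π e ∧
    ∀ y, (E h).1 (inclusion (eFibre_subset π e) y) = inclusion (eFibre_subset π e) (h y)

/-- A permutation of Y with a covariant extension must commute with every fibre-preserving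
automorphism. Here an extension is supplied by 𝒢^fib; after the cut-off it is unique, hence
multiplicative in h. -/
theorem IsGroupFactor.exists_extensionHom (hπ : IsGroupFactor T π)
    (he : IsMinimalIdempotent e)
    (hΓ : ∀ h : Equiv.Perm (eFibre π e), h ∈ structureGroupFibZero π e he) :
    ∃ E : Equiv.Perm (eFibre π e) →* covariantGroup π e, IsExtensionHom E := by
  have hex : ∀ h : Equiv.Perm (eFibre π e), ∃ g ∈ covariantFib π e ⊓ regularFixing π e,
      ∀ y, g (inclusion (eFibre_subset π e) y) = inclusion (eFibre_subset π e) (h y) := by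
    intro h
    obtain ⟨g, hg, hgh⟩ := hΓ h
    obtain ⟨k, hk, hk1, hk2⟩ :=
      hπ.exists_cutoff (e := e) ⟨hπ.structureGroup_le he hg.1, hg.2⟩ 0
    refine ⟨k, ⟨hk, fun x hx => hk2 x (by rwa [sub_zero])⟩, fun y => ?_⟩
    rw [hk1, hgh]
    rw [sub_zero, show π (inclusion (eFibre_subset π e) y) = 0 from hπ.map_eFibre he y]
    exact zero_mem _
  choose E hE hEy using hex
  refine ⟨MonoidHom.mk' (fun h => ⟨E h, (hE h).1.1⟩) fun h k => Subtype.ext ?_,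
    fun h => ⟨hE h, hEy h⟩⟩
  refine hπ.covariant_ext he (hE _) (mul_mem (hE h) (hE k)) fun y => ?_
  change _ = E h (E k _)
  rw [hEy, hEy, hEy]
  rfl

theorem IsExtensionHom.isCovariantExtension (hπ : IsGroupFactor T π)
    {E : Equiv.Perm (eFibre π e) →* covariantGroup π e} (hE : IsExtensionHom E)
    (a : Equiv.Perm (eFibre π e)) : IsCovariantExtension π e a (E a) := by
  refine ⟨fun α y => ?_, fun x hx => (hE a).1.2 x ?_⟩
  · rw [covariantGroup_apply_comm (E a).2, (hE a).2]
  · rwa [hπ.autEqOrbit_eq] at hx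

end StructureGroup

/-! ### The matrix form of the kernel -/

section Kernel

variable {T : Type w} [CommGroup T] {X Z : Type u} [TopologicalSpace X] [CompactSpace X]
  [T2Space X] [MulAction T X] [ContinuousConstSMul T X] [AddCommGroup Z] {π : X → Z}
  {e : ellis T X}

theorem ellis_mul_kernel (he : IsMinimalIdempotent e) {f g : Function.End X}
    (hf : f ∈ ellis T X) (hg : g ∈ ellisKernel T X) : f * g ∈ ellisKernel T X := by
  obtain ⟨a, b, rfl⟩ := he.mem_kernel_iff.1 hg
  exact he.mem_kernel_iff.2 ⟨⟨f, hf⟩ * a, b, by simp only [mul_assoc]; rfl⟩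

theorem kernel_mul_ellis (he : IsMinimalIdempotent e) {f g : Function.End X}
    (hf : f ∈ ellis T X) (hg : g ∈ ellisKernel T X) : g * f ∈ ellisKernel T X := by
  obtain ⟨a, b, rfl⟩ := he.mem_kernel_iff.1 hg
  exact he.mem_kernel_iff.2 ⟨a, b * ⟨f, hf⟩, by simp only [← mul_assoc]; rfl⟩

theorem minimalIdempotent_mem_kernel (he : IsMinimalIdempotent e) : e.1 ∈ ellisKernel T X :=
  he.mem_kernel_iff.2 ⟨1, 1, by rw [one_mul, mul_one]⟩

/-- The map `x ↦ g (e x)`, as an element of the semigroup of all maps. -/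
def permEnd (e : ellis T X) (g : Equiv.Perm (eRange e)) : Function.End X := liftPerm e g

theorem permEnd_apply (g : Equiv.Perm (eRange e)) (x : X) :
    permEnd e g x = g ⟨e.1 x, mem_range_self x⟩ := rfl

theorem permEnd_mem_kernel (he : IsMinimalIdempotent e) {g : Equiv.Perm (eRange e)}
    (hg : g ∈ structureGroup e he) : permEnd e g ∈ ellisKernel T X := by
  have h : permEnd e g = e.1 * permEnd e g :=
    funext fun x => (he.apply_eRange (g _)).symm
  rw [h]
  exact kernel_mul_ellis he (liftPerm_mem_ellisSet he hg) (minimalIdempotent_mem_kernel he)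

theorem permEnd_mul (he : IsMinimalIdempotent e) (g k : Equiv.Perm (eRange e)) :
    permEnd e (g * k) = permEnd e g * permEnd e k := by
  funext x
  change _ = (g ⟨e.1 (k _), _⟩ : X)
  simp only [he.apply_eRange]
  rfl

theorem permEnd_one : permEnd e 1 = e.1 := rfl

theorem permEnd_apply_coe (he : IsMinimalIdempotent e) (g : Equiv.Perm (eRange e))
    (x : eRange e) : permEnd e g x = g x := by
  simp only [permEnd_apply, he.apply_eRange]

theorem permEnd_injective (he : IsMinimalIdempotent e) {g k : Equiv.Perm (eRange e)}
    (h : permEnd e g = permEnd e k) : g = k :=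
  Equiv.ext fun x => Subtype.ext (by
    rw [← permEnd_apply_coe he, h, permEnd_apply_coe he])

/-- The inclusion of the structure group, realised as the group of all covariant permutations,
in the kernel. -/
def kernelLift (he : IsMinimalIdempotent e) (hG : covariantGroup π e ≤ structureGroup e he) :
    covariantGroup π e →ₙ* ellisKernel T X where
  toFun g := ⟨permEnd e g, permEnd_mem_kernel he (hG g.2)⟩
  map_mul' g k := Subtype.ext (permEnd_mul he g k)

theorem kernelLift_isSandwichGroup [MulAction.IsMinimal T X] [TopologicalSpace Z]
    [IsTopologicalAddGroup Z] [T2Space Z] [MulAction T Z] (hπ : IsGroupFactor T π)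
    (he : IsMinimalIdempotent e) (hG : covariantGroup π e ≤ structureGroup e he) :
    ReesMatrix.IsSandwichGroup (kernelLift he hG) where
  injective g k h := Subtype.ext (permEnd_injective he (congrArg Subtype.val h))
  corner s := by
    obtain ⟨g, hg, hgs⟩ := exists_mem_structureGroup he ⟨s.1, s.2.1⟩
    refine ⟨⟨g, hπ.structureGroup_le he hg⟩, Subtype.ext (funext fun x => ?_)⟩
    exact (hgs ⟨e.1 x, mem_range_self x⟩).symm
  simple s := by
    obtain ⟨a, b, hab⟩ := he.mem_kernel_iff.1 s.2
    have he' := minimalIdempotent_mem_kernel he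
    refine ⟨⟨_, ellis_mul_kernel he a.2 he'⟩, ⟨_, kernel_mul_ellis he b.2 he'⟩,
      Subtype.ext (hab.trans (funext fun x => ?_))⟩
    change a.1 (e.1 (b.1 x)) = a.1 (e.1 (e.1 (e.1 (b.1 x))))
    rw [he.apply_apply, he.apply_apply]

/-- The restriction of the fibre preserving elements of the kernel to the fibre of `0`. -/
def fibRestrict (T : Type w) [CommGroup T] [MulAction T X] [ContinuousConstSMul T X] (π : X → Z) :
    fibKernel T π →ₙ* fibKernelZero T π where
  toFun f := ⟨fun x => ⟨f.1 x, (f.2.2 x).trans x.2⟩, f.1, f.2, fun _ => rfl⟩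
  map_mul' _ _ := rfl

theorem fibRestrict_surjective : Function.Surjective (fibRestrict T π) := by
  rintro ⟨h, f, hf, hfh⟩
  exact ⟨⟨f, hf⟩, Subtype.ext (funext fun x => Subtype.ext (hfh x).symm)⟩

theorem fibRestrict_eq_iff {f g : fibKernel T π} :
    fibRestrict T π f = fibRestrict T π g ↔ ∀ x, π x = 0 → f.1 x = g.1 x := by
  constructor
  · intro h x hx
    exact congrArg Subtype.val (congrFun (congrArg Subtype.val h) ⟨x, hx⟩)
  · intro h
    exact Subtype.ext (funext fun x => Subtype.ext (h x x.2))

variable [MulAction.IsMinimal T X] [TopologicalSpace Z]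
  [IsTopologicalAddGroup Z] [T2Space Z] [MulAction T Z]

theorem permEnd_mem_fibKernel (hπ : IsGroupFactor T π) (he : IsMinimalIdempotent e)
    (hG : covariantGroup π e ≤ structureGroup e he) {g : Equiv.Perm (eRange e)}
    (hg : g ∈ covariantFib π e) : permEnd e g ∈ fibKernel T π :=
  ⟨permEnd_mem_kernel he (hG hg.1), fun x => (hg.2 _).trans (hπ.idempotent_apply he.1 x)⟩

/-- The inclusion of the permutation group of the fibre of `0` in `M^fib`. -/
def fibLift (hπ : IsGroupFactor T π) (he : IsMinimalIdempotent e)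
    (hG : covariantGroup π e ≤ structureGroup e he)
    {E : Equiv.Perm (eFibre π e) →* covariantGroup π e} (hE : IsExtensionHom E) :
    Equiv.Perm (eFibre π e) →ₙ* fibKernel T π where
  toFun h := ⟨permEnd e (E h), permEnd_mem_fibKernel hπ he hG (hE h).1.1⟩
  map_mul' h k := Subtype.ext
    ((congrArg (fun g => permEnd e g.1) (map_mul E h k)).trans (permEnd_mul he (E h) (E k)))

theorem fibRestrict_comp_fibLift_isSandwichGroup (hπ : IsGroupFactor T π)
    (he : IsMinimalIdempotent e) (hG : covariantGroup π e ≤ structureGroup e he)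
    {E : Equiv.Perm (eFibre π e) →* covariantGroup π e} (hE : IsExtensionHom E) :
    ReesMatrix.IsSandwichGroup ((fibRestrict T π).comp (fibLift hπ he hG hE)) where
  injective h k hhk := by
    refine Equiv.ext fun y => ?_
    have h1 := fibRestrict_eq_iff.1 hhk y (hπ.map_eFibre he y)
    have h2 : ∀ h, (fibLift hπ he hG hE h).1 y = h y := fun h => by
      change permEnd e (E h) (inclusion (eFibre_subset π e) y) = _
      rw [permEnd_apply_coe he, (hE h).2]
    rw [h2, h2] at h1
    exact Subtype.ext h1
  corner s := by
    obtain ⟨f, rfl⟩ := fibRestrict_surjective s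
    obtain ⟨g, hg, hgf⟩ := exists_mem_structureGroup he ⟨f.1, f.2.1.1⟩
    have hgc : g ∈ covariantFib π e := ⟨hπ.structureGroup_le he hg, fun x => by
      rw [hgf, hπ.idempotent_apply he.1]
      exact f.2.2 x⟩
    obtain ⟨h, hh⟩ := hπ.exists_restrict he hgc.2
    refine ⟨h, ?_⟩
    simp only [MulHom.comp_apply, ← map_mul]
    refine fibRestrict_eq_iff.2 fun x hx => ?_
    have hE1 : (fibLift hπ he hG hE 1).1 = e.1 := by
      change permEnd e (E 1) = _
      rw [map_one]
      exact permEnd_one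
    change (fibLift hπ he hG hE 1).1 (f.1 ((fibLift hπ he hG hE 1).1 x)) = permEnd e (E h) x
    rw [hE1]
    have h1 := (hE h).2 ⟨e.1 x, x, hx, rfl⟩
    rw [← hh] at h1
    exact ((congrArg Subtype.val h1).trans (hgf ⟨e.1 x, mem_range_self x⟩)).symm
  simple s := by
    obtain ⟨f, rfl⟩ := fibRestrict_surjective s
    obtain ⟨a, b, hab⟩ := he.mem_kernel_iff.1 f.2.1
    obtain ⟨ξ, hξ⟩ := hπ.ellis_shift a
    obtain ⟨ζ, hζ⟩ := hπ.ellis_shift b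
    -- In f = a e b the factors may shift the fibres by opposite translations. Writing e = F⁻¹ e F
    -- with F of the same translation as a makes both a F⁻¹ and F b fibre preserving.
    obtain ⟨F, hF, hFξ⟩ := hπ.exists_structureGroup_shift he ξ
    have hsum : ζ + ξ = 0 := by
      obtain ⟨x⟩ := hπ.nonempty
      have h := f.2.2 x
      rw [hab, ellis_mul_apply, ellis_mul_apply, hξ, hπ.idempotent_apply he.1, hζ,
        add_assoc, add_eq_left] at h
      exact h
    have hF' : ∀ x, π (F⁻¹ x) = π x - ξ := fun x => by
      rw [eq_sub_iff_add_eq, ← hFξ, perm_apply_inv]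
    refine ⟨fibRestrict T π ⟨a.1 * permEnd e F⁻¹,
      ellis_mul_kernel he a.2 (permEnd_mem_kernel he (inv_mem hF)), fun x => ?_⟩,
      fibRestrict T π ⟨permEnd e F * b.1,
      kernel_mul_ellis he b.2 (permEnd_mem_kernel he hF), fun x => ?_⟩, ?_⟩
    · change π (a.1 (F⁻¹ _)) = _
      rw [hξ, hF', sub_add_cancel, hπ.idempotent_apply he.1]
    · change π (F _) = _
      rw [hFξ, hπ.idempotent_apply he.1, hζ, add_assoc, hsum, add_zero]
    · simp only [MulHom.comp_apply, ← map_mul]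
      refine fibRestrict_eq_iff.2 fun x hx => ?_
      rw [hab]
      have h : (a * e * b).1 =
          a.1 * permEnd e F⁻¹ * permEnd e (E 1) * (permEnd e F * b.1) := by
        have h1 : permEnd e F⁻¹ * permEnd e (E 1) * permEnd e F =
            e.1 := by
          rw [map_one, ← permEnd_mul he, ← permEnd_mul he]
          change permEnd e (F⁻¹ * 1 * F) = _
          rw [mul_one, inv_mul_cancel]
          rfl
        change a.1 * e.1 * b.1 = _
        rw [← h1]
        simp only [mul_assoc]
      rw [h]
      rfl

end Kernel

section

variable {S : Type*} [Semigroup S] {e : S}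

theorem ReesMatrix.LeftIdem.mul_self (p : ReesMatrix.LeftIdem e) : p.1 * p.1 = p.1 := by
  nth_rewrite 1 [← p.2.1]
  rw [mul_assoc, p.2.2, p.2.1]

theorem ReesMatrix.RightIdem.mul_self (q : ReesMatrix.RightIdem e) : q.1 * q.1 = q.1 := by
  nth_rewrite 2 [← q.2.1]
  rw [← mul_assoc, q.2.2, q.2.1]

end

/-! ### Comparison of the kernel with its restriction to the fibre of 0 -/

section KernelMatrix

variable {T : Type w} [CommGroup T] {X Z : Type u} [TopologicalSpace X] [CompactSpace X]
  [T2Space X] [MulAction T X] [ContinuousConstSMul T X] [AddCommGroup Z] {π : X → Z}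
  {e : ellis T X} [MulAction.IsMinimal T X] [TopologicalSpace Z]
  [IsTopologicalAddGroup Z] [T2Space Z] [MulAction T Z]

theorem kernel_isIdempotentElem {p : ellisKernel T X} (hp : p * p = p) :
    IsIdempotentElem (⟨p.1, p.2.1⟩ : ellis T X) := by
  have h : p.1 * p.1 = p.1 := congrArg Subtype.val hp
  exact Subtype.ext h

theorem IsGroupFactor.kernel_idempotent_mem (hπ : IsGroupFactor T π) {p : ellisKernel T X}
    (hp : p * p = p) : p.1 ∈ fibKernel T π :=
  ⟨p.2, hπ.idempotent_apply (kernel_isIdempotentElem hp)⟩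

/-- Idempotents of the kernel are determined by their restriction to the fibre of `0`. -/
theorem IsGroupFactor.kernel_idempotent_ext (hπ : IsGroupFactor T π) (hU : IsUSF T π)
    {p q : ellisKernel T X} (hp : p * p = p) (hq : q * q = q)
    (h : ∀ x, π x = 0 → p.1 x = q.1 x) : p = q := by
  refine Subtype.ext (funext fun x => ?_)
  by_cases hx : π x ∈ autShifts T π
  -- An automorphism of shift −π x takes x to the fibre of 0, and p and q commute with it.
  · obtain ⟨α, hα⟩ := neg_mem hx
    have h1 := h (α.1 x) (by rw [hα, add_neg_cancel])
    have h2 := ellis_comm_aut ⟨p.1, p.2.1⟩ α x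
    have h3 := ellis_comm_aut ⟨q.1, q.2.1⟩ α x
    exact α.1.injective (h2.trans (h1.trans h3.symm))
  · have h1 := hπ.idempotent_apply_eq hU (kernel_isIdempotentElem hp) hx
    have h2 := hπ.idempotent_apply_eq hU (kernel_isIdempotentElem hq) hx
    exact h1.trans h2.symm

/-- If `e f e` is the identity on the fibre of `0`, then it is a covariant permutation which is
the identity there. -/
theorem exists_corner_eq_of_fibRestrict (hπ : IsGroupFactor T π)
    (he : IsMinimalIdempotent e) (hG : covariantGroup π e ≤ structureGroup e he) {f : fibKernel T π}
    (hf : ∀ x, π x = 0 → e.1 (f.1 (e.1 x)) = e.1 x) :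
    ∃ g : covariantGroup π e, kernelLift he hG 1 * ⟨f.1, f.2.1⟩ * kernelLift he hG 1 =
      kernelLift he hG g ∧ (∀ x, π x = 0 → permEnd e g⁻¹.1 x = e.1 x) := by
  obtain ⟨g, hg⟩ := (kernelLift_isSandwichGroup hπ he hG).corner ⟨f.1, f.2.1⟩
  refine ⟨g, hg, fun x hx => ?_⟩
  have h1 : permEnd e g.1 x = e.1 x :=
    (congrFun (congrArg Subtype.val hg) x).symm.trans (hf x hx)
  have h2 : g.1 ⟨e.1 x, mem_range_self x⟩ = ⟨e.1 x, mem_range_self x⟩ := Subtype.ext h1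
  change ((g.1⁻¹ ⟨e.1 x, mem_range_self x⟩ : eRange e) : X) = e.1 x
  nth_rewrite 1 [← h2]
  rw [perm_inv_apply]

section

variable (hπ : IsGroupFactor T π) (he : IsMinimalIdempotent e)
  (hG : covariantGroup π e ≤ structureGroup e he)
  {E : Equiv.Perm (eFibre π e) →* covariantGroup π e} (hE : IsExtensionHom E)

theorem fibLift_one : (fibLift hπ he hG hE 1).1 = (kernelLift he hG 1).1 :=
  congrArg (fun g : covariantGroup π e => permEnd e g.1) (map_one E)

theorem fibLift_one_apply (x : X) : (fibLift hπ he hG hE 1).1 x = e.1 x :=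
  congrFun (fibLift_one hπ he hG hE) x

/-- The restriction of idempotents in a minimal left ideal to the fibre of `0`. -/
def leftRestrict (p : ReesMatrix.LeftIdem (kernelLift he hG 1)) :
    ReesMatrix.LeftIdem ((fibRestrict T π).comp (fibLift hπ he hG hE) 1) :=
  ⟨fibRestrict T π ⟨p.1.1, hπ.kernel_idempotent_mem p.mul_self⟩, by
    rw [MulHom.comp_apply, ← map_mul]
    congr 1
    have h := congrArg Subtype.val p.2.1
    refine Subtype.ext (Eq.trans ?_ h)
    exact congrArg (p.1.1 * ·) (fibLift_one hπ he hG hE), by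
    rw [MulHom.comp_apply, ← map_mul]
    congr 1
    have h := congrArg Subtype.val p.2.2
    refine Subtype.ext (Eq.trans ?_ (h.trans
      (fibLift_one hπ he hG hE).symm))
    exact congrArg (· * p.1.1) (fibLift_one hπ he hG hE)⟩

/-- The restriction of idempotents in a minimal right ideal to the fibre of `0`. -/
def rightRestrict (q : ReesMatrix.RightIdem (kernelLift he hG 1)) :
    ReesMatrix.RightIdem ((fibRestrict T π).comp (fibLift hπ he hG hE) 1) :=
  ⟨fibRestrict T π ⟨q.1.1, hπ.kernel_idempotent_mem q.mul_self⟩, by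
    rw [MulHom.comp_apply, ← map_mul]
    congr 1
    have h := congrArg Subtype.val q.2.1
    refine Subtype.ext (Eq.trans ?_ h)
    exact congrArg (· * q.1.1) (fibLift_one hπ he hG hE), by
    rw [MulHom.comp_apply, ← map_mul]
    congr 1
    have h := congrArg Subtype.val q.2.2
    refine Subtype.ext (Eq.trans ?_ (h.trans
      (fibLift_one hπ he hG hE).symm))
    exact congrArg (q.1.1 * ·) (fibLift_one hπ he hG hE)⟩

theorem leftRestrict_injective (hU : IsUSF T π) :
    Function.Injective (leftRestrict hπ he hG hE) := by
  intro p q h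
  exact Subtype.ext (hπ.kernel_idempotent_ext hU p.mul_self q.mul_self
    (fibRestrict_eq_iff.1 (congrArg Subtype.val h)))

theorem rightRestrict_injective (hU : IsUSF T π) :
    Function.Injective (rightRestrict hπ he hG hE) := by
  intro p q h
  exact Subtype.ext (hπ.kernel_idempotent_ext hU p.mul_self q.mul_self
    (fibRestrict_eq_iff.1 (congrArg Subtype.val h)))

/-- A lift f of the given idempotent need not be idempotent away from the fibre of 0. Its corner e f
e is a group element g that is trivial over 0, and f g⁻¹ is an idempotent with the same restriction.
-/
theorem leftRestrict_surjective : Function.Surjective (leftRestrict hπ he hG hE) := by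
  rintro ⟨s, hs1, hs2⟩
  obtain ⟨f, rfl⟩ := fibRestrict_surjective s
  rw [MulHom.comp_apply, ← map_mul, fibRestrict_eq_iff] at hs1 hs2
  have hs1' : ∀ x, π x = 0 → f.1 (e.1 x) = f.1 x := fun x hx => by
    rw [← fibLift_one_apply hπ he hG hE]
    exact hs1 x hx
  have hs2' : ∀ x, π x = 0 → e.1 (f.1 x) = e.1 x := fun x hx => by
    rw [← fibLift_one_apply hπ he hG hE, ← fibLift_one_apply hπ he hG hE x]
    exact hs2 x hx
  obtain ⟨g, hg, hg0⟩ := exists_corner_eq_of_fibRestrict hπ he hG (f := f)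
    fun x hx => by rw [hs1' x hx, hs2' x hx]
  set γ := kernelLift (π := π) he hG
  have hl : ∀ g, γ 1 * γ g = γ g := fun g => by rw [← map_mul, one_mul]
  have hr : ∀ g, γ g * γ 1 = γ g := fun g => by rw [← map_mul, mul_one]
  refine ⟨⟨⟨f.1, f.2.1⟩ * γ g⁻¹, ?_, ?_⟩, Subtype.ext (fibRestrict_eq_iff.2 fun x hx => ?_)⟩
  · rw [mul_assoc, hr]
  · rw [← hl g⁻¹, ← mul_assoc, ← mul_assoc, hg, ← map_mul, mul_inv_cancel]
  · change f.1 (permEnd e g⁻¹.1 x) = f.1 x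
    rw [hg0 x hx, hs1' x hx]

/-- Mirror image of `leftRestrict_surjective`: the correction is g⁻¹ f. -/
theorem rightRestrict_surjective : Function.Surjective (rightRestrict hπ he hG hE) := by
  rintro ⟨s, hs1, hs2⟩
  obtain ⟨f, rfl⟩ := fibRestrict_surjective s
  rw [MulHom.comp_apply, ← map_mul, fibRestrict_eq_iff] at hs1 hs2
  have hs1' : ∀ x, π x = 0 → e.1 (f.1 x) = f.1 x := fun x hx => by
    rw [← fibLift_one_apply hπ he hG hE]
    exact hs1 x hx
  have hs2' : ∀ x, π x = 0 → f.1 (e.1 x) = e.1 x := fun x hx => by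
    rw [← fibLift_one_apply hπ he hG hE x]
    exact hs2 x hx
  obtain ⟨g, hg, hg0⟩ := exists_corner_eq_of_fibRestrict hπ he hG (f := f)
    fun x hx => by rw [hs2' x hx, he.apply_apply]
  set γ := kernelLift (π := π) he hG
  have hl : ∀ g, γ 1 * γ g = γ g := fun g => by rw [← map_mul, one_mul]
  have hr : ∀ g, γ g * γ 1 = γ g := fun g => by rw [← map_mul, mul_one]
  refine ⟨⟨γ g⁻¹ * ⟨f.1, f.2.1⟩, ?_, ?_⟩, Subtype.ext (fibRestrict_eq_iff.2 fun x hx => ?_)⟩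
  · rw [← mul_assoc, hl]
  · rw [← hr g⁻¹, mul_assoc, mul_assoc, ← mul_assoc (γ 1), hg, ← map_mul, inv_mul_cancel]
  · change permEnd e g⁻¹.1 (f.1 x) = f.1 x
    rw [hg0 _ ((f.2.2 x).trans hx), hs1' x hx]

end

/-- The kernel is the matrix semigroup over the group of all covariant permutations whose matrix
is the extension of the matrix of the restriction of `M^fib` to the fibre of `0`. -/
theorem IsGroupFactor.exists_kernel_matrix (hπ : IsGroupFactor T π) (hU : IsUSF T π)
    (he : IsMinimalIdempotent e) (hG : covariantGroup π e ≤ structureGroup e he)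
    {E : Equiv.Perm (eFibre π e) →* covariantGroup π e} (hE : IsExtensionHom E) :
    ∃ (I Λ : Type u) (A : Λ → I → Equiv.Perm (eFibre π e)),
      Nonempty (ReesMatrix A ≃* fibKernelZero T π) ∧
      Nonempty (ReesMatrix (fun l i => E (A l i)) ≃* ellisKernel T X) := by
  obtain ⟨A, hA, ⟨Ψ⟩⟩ := (kernelLift_isSandwichGroup hπ he hG).exists_equiv
  obtain ⟨A₀, hA₀, ⟨Ψ₀⟩⟩ := (fibRestrict_comp_fibLift_isSandwichGroup hπ he hG hE).exists_equiv
  refine ⟨_, _, A₀, ⟨Ψ₀⟩, ?_⟩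
  let σ := Equiv.ofBijective _ ⟨leftRestrict_injective hπ he hG hE hU,
    leftRestrict_surjective hπ he hG hE⟩
  let τ := Equiv.ofBijective _ ⟨rightRestrict_injective hπ he hG hE hU,
    rightRestrict_surjective hπ he hG hE⟩
  -- Both sides are covariant, agree on Y, and are trivial on the regular fibres, the left one being
  -- a product of idempotents.
  have key : ∀ q p, A q p = E (A₀ (τ q) (σ p)) := by
    intro q p
    have hp : IsIdempotentElem (⟨p.1.1, p.1.2.1⟩ : ellis T X) :=
      kernel_isIdempotentElem p.mul_self
    have hq : IsIdempotentElem (⟨q.1.1, q.1.2.1⟩ : ellis T X) :=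
      kernel_isIdempotentElem q.mul_self
    have hval : ∀ x : eRange e, ((A q p).1 x : X) = q.1.1 (p.1.1 x) := fun x => by
      rw [← permEnd_apply_coe he]
      exact congrFun (congrArg Subtype.val (hA q p)) x
    refine Subtype.ext (hπ.covariant_ext he ⟨⟨(A q p).2, fun x => ?_⟩, fun x hx =>
      Subtype.ext ?_⟩ (hE _).1 fun y => Subtype.ext ?_)
    · rw [hval]
      exact (hπ.idempotent_apply hq _).trans (hπ.idempotent_apply hp _)
    · rw [hval]
      refine (congrArg q.1.1 (hπ.idempotent_apply_eq hU hp hx)).trans ?_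
      exact hπ.idempotent_apply_eq hU hq hx
    · have h := hA₀ (τ q) (σ p)
      have h' := fibRestrict_eq_iff.1 (h.trans (map_mul (fibRestrict T π) _ _).symm) y
        (hπ.map_eFibre he y)
      rw [hval, ← permEnd_apply_coe he]
      exact h'.symm
  exact ⟨(ReesMatrix.equivOfEquivalent σ.symm τ.symm (MulEquiv.refl _) (fun _ => 1) (fun _ => 1)
    (fun l i => by simp [key])).trans Ψ⟩

end KernelMatrix

/-! ### Extending automorphisms of the permutation group of a fibre -/

/-- A permutation group with nontrivial centre has no nontrivial automorphism. -/
theorem perm_mulEquiv_eq_self {Y : Type*} {c : Equiv.Perm Y} (hc : ∀ h, c * h = h * c)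
    (hne : c ≠ 1) (φ : Equiv.Perm Y ≃* Equiv.Perm Y) (h : Equiv.Perm Y) : φ h = h := by
  classical
  obtain ⟨y, hy⟩ : ∃ y, c y ≠ y := by
    by_contra hcon
    push Not at hcon
    exact hne (Equiv.ext hcon)
  -- A third point z would give a transposition of c y and z that does not commute with c.
  have hY : ∀ z, z = y ∨ z = c y := by
    intro z
    by_contra hz
    push Not at hz
    have h1 := Equiv.congr_fun (hc (Equiv.swap (c y) z)) y
    rw [Equiv.Perm.mul_apply, Equiv.Perm.mul_apply, Equiv.swap_apply_left,
      Equiv.swap_apply_of_ne_of_ne hy.symm hz.1.symm] at h1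
    exact hz.2 h1.symm
  have hperm : ∀ k : Equiv.Perm Y, k = 1 ∨ k = c := by
    intro k
    rcases hY (k y) with h1 | h1
    · have h2 : k (c y) = c y := by
        have h := Equiv.congr_fun (hc k) y
        rw [Equiv.Perm.mul_apply, Equiv.Perm.mul_apply, h1] at h
        exact h.symm
      exact Or.inl (Equiv.ext fun z => by rcases hY z with rfl | rfl <;> assumption)
    · have h2 : k (c y) = c (c y) := by
        have h := Equiv.congr_fun (hc k) y
        rw [Equiv.Perm.mul_apply, Equiv.Perm.mul_apply, h1] at h
        exact h.symm
      exact Or.inr (Equiv.ext fun z => by rcases hY z with rfl | rfl <;> assumption)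
  rcases hperm h with rfl | rfl
  · exact map_one φ
  · exact (hperm (φ h)).resolve_left fun h1 => hne (φ.injective (h1.trans (map_one φ).symm))

/-! ### Wreath product coordinates -/

section Wreath

variable {S Y Z : Type*} [AddCommGroup Z]

/-- The permutation `(z, y) ↦ (z + ξ, c z y)`, transported along a bijection with `Z × Y`. -/
def wreathPerm (Ξ : S ≃ Z × Y) (ξ : Z) (c : Z → Equiv.Perm Y) : Equiv.Perm S where
  toFun x := Ξ.symm ((Ξ x).1 + ξ, c (Ξ x).1 (Ξ x).2)
  invFun x := Ξ.symm ((Ξ x).1 - ξ, (c ((Ξ x).1 - ξ))⁻¹ (Ξ x).2)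
  left_inv x := by
    rw [Equiv.symm_apply_eq, Equiv.apply_symm_apply]
    simp
  right_inv x := by
    rw [Equiv.symm_apply_eq, Equiv.apply_symm_apply]
    simp

theorem wreathPerm_apply_symm (Ξ : S ≃ Z × Y) (ξ : Z) (c : Z → Equiv.Perm Y) (z : Z) (y : Y) :
    wreathPerm Ξ ξ c (Ξ.symm (z, y)) = Ξ.symm (z + ξ, c z y) := by
  change Ξ.symm _ = _
  rw [Equiv.apply_symm_apply]

theorem wreathPerm_mul (Ξ : S ≃ Z × Y) (ξ ζ : Z) (c d : Z → Equiv.Perm Y) :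
    wreathPerm Ξ ξ c * wreathPerm Ξ ζ d = wreathPerm Ξ (ζ + ξ) fun z => c (z + ζ) * d z := by
  refine Equiv.ext fun x => ?_
  obtain ⟨⟨z, y⟩, rfl⟩ := Ξ.symm.surjective x
  rw [Equiv.Perm.mul_apply, wreathPerm_apply_symm, wreathPerm_apply_symm, wreathPerm_apply_symm,
    add_assoc, Equiv.Perm.mul_apply]

theorem wreathPerm_inj [Nonempty Y] {Ξ : S ≃ Z × Y} {ξ ζ : Z} {c d : Z → Equiv.Perm Y}
    (h : wreathPerm Ξ ξ c = wreathPerm Ξ ζ d) : ξ = ζ ∧ c = d := by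
  have h1 : ∀ z y, (z + ξ, c z y) = (z + ζ, d z y) := fun z y => Ξ.symm.injective (by
    rw [← wreathPerm_apply_symm, h, wreathPerm_apply_symm])
  obtain ⟨y⟩ := ‹Nonempty Y›
  exact ⟨add_left_cancel (congrArg Prod.fst (h1 0 y)),
    funext fun z => Equiv.ext fun y => congrArg Prod.snd (h1 z y)⟩

theorem exists_eq_wreathPerm (Ξ : S ≃ Z × Y) (g : Equiv.Perm S) (ξ : Z)
    (hg : ∀ x, (Ξ (g x)).1 = (Ξ x).1 + ξ) : ∃ c, g = wreathPerm Ξ ξ c := by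
  have hg' : ∀ x, (Ξ (g⁻¹ x)).1 = (Ξ x).1 - ξ := fun x => by
    rw [eq_sub_iff_add_eq, ← hg, perm_apply_inv]
  let c : Z → Equiv.Perm Y := fun z =>
    { toFun := fun y => (Ξ (g (Ξ.symm (z, y)))).2
      invFun := fun y => (Ξ (g⁻¹ (Ξ.symm (z + ξ, y)))).2
      left_inv := fun y => by
        have h : ((z + ξ, (Ξ (g (Ξ.symm (z, y)))).2) : Z × Y) = Ξ (g (Ξ.symm (z, y))) :=
          Prod.ext (by rw [hg, Equiv.apply_symm_apply]) rfl
        simp only [h, Equiv.symm_apply_apply, perm_inv_apply, Equiv.apply_symm_apply]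
      right_inv := fun y => by
        have h : ((z, (Ξ (g⁻¹ (Ξ.symm (z + ξ, y)))).2) : Z × Y) =
            Ξ (g⁻¹ (Ξ.symm (z + ξ, y))) :=
          Prod.ext (by rw [hg', Equiv.apply_symm_apply, add_sub_cancel_right]) rfl
        simp only [h, Equiv.symm_apply_apply, perm_apply_inv, Equiv.apply_symm_apply] }
  refine ⟨c, Equiv.ext fun x => ?_⟩
  obtain ⟨⟨z, y⟩, rfl⟩ := Ξ.symm.surjective x
  rw [wreathPerm_apply_symm, Equiv.eq_symm_apply]
  exact Prod.ext (by rw [hg, Equiv.apply_symm_apply]) rfl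

/-- Automorphisms of the permutation group of `Y` act on the wreath products. -/
theorem exists_wreath_mulEquiv [Nonempty Y] (Ξ : S ≃ Z × Y) (G : Subgroup (Equiv.Perm S))
    (P : (Z → Equiv.Perm Y) → Prop) (hG : ∀ g, g ∈ G ↔ ∃ ξ c, P c ∧ g = wreathPerm Ξ ξ c)
    (hP : ∀ (φ : Equiv.Perm Y ≃* Equiv.Perm Y) c, P c → P fun z => φ (c z))
    (φ : Equiv.Perm Y ≃* Equiv.Perm Y) :
    ∃ Φ : G ≃* G, ∀ g ξ c, g.1 = wreathPerm Ξ ξ c →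
      (Φ g).1 = wreathPerm Ξ ξ fun z => φ (c z) := by
  have hG' : ∀ g : G, ∃ ξ c, P c ∧ g.1 = wreathPerm Ξ ξ c := fun g => (hG g).1 g.2
  choose ξ c hPc hgc using hG'
  -- Defined for all φ at once, so that the inverse is F at φ⁻¹; uniqueness of the coordinates makes
  -- the choices harmless.
  let F : (Equiv.Perm Y ≃* Equiv.Perm Y) → G → G := fun φ g =>
    ⟨wreathPerm Ξ (ξ g) fun z => φ (c g z), (hG _).2 ⟨_, _, hP φ _ (hPc g), rfl⟩⟩
  have hFv : ∀ φ g, (F φ g).1 = wreathPerm Ξ (ξ g) fun z => φ (c g z) := fun _ _ => rfl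
  have hF : ∀ φ g ζ d, g.1 = wreathPerm Ξ ζ d →
      (F φ g).1 = wreathPerm Ξ ζ fun z => φ (d z) := by
    intro φ g ζ d h
    obtain ⟨h1, h2⟩ := wreathPerm_inj ((hgc g).symm.trans h)
    rw [← h1, ← h2]
  refine ⟨⟨⟨F φ, F φ.symm, fun g => Subtype.ext ?_, fun g => Subtype.ext ?_⟩,
    fun g k => Subtype.ext ?_⟩, hF φ⟩
  · rw [hF φ.symm (F φ g) _ _ (hFv φ g)]
    simp only [MulEquiv.symm_apply_apply]
    exact (hgc g).symm
  · rw [hF φ (F φ.symm g) _ _ (hFv φ.symm g)]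
    simp only [MulEquiv.apply_symm_apply]
    exact (hgc g).symm
  · change (F φ (g * k)).1 = (F φ g).1 * (F φ k).1
    rw [hF φ (g * k) _ _ ((congrArg₂ (· * ·) (hgc g) (hgc k)).trans (wreathPerm_mul _ _ _ _ _))]
    simp only [hFv, wreathPerm_mul, map_mul]

end Wreath

/-! ### Automorphisms of S_Y acting on the covariant group -/

section Extension

variable {T : Type w} [CommGroup T] {X Z : Type u} [TopologicalSpace X] [CompactSpace X]
  [T2Space X] [MulAction T X] [ContinuousConstSMul T X] [AddCommGroup Z] {π : X → Z}
  {e : ellis T X} [MulAction.IsMinimal T X] [TopologicalSpace Z]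
  [IsTopologicalAddGroup Z] [T2Space Z] [MulAction T Z]

theorem IsGroupFactor.nonempty_eFibre (hπ : IsGroupFactor T π) : Nonempty (eFibre π e) :=
  let ⟨x, hx⟩ := hπ.isFactorMap.surjective 0
  ⟨⟨e.1 x, x, hx, rfl⟩⟩

/-- If the automorphisms act freely on the factor, then `e X` is trivialised over the factor by
transport maps that are equivariant for the automorphisms. -/
theorem IsGroupFactor.exists_transport (hπ : IsGroupFactor T π) (he : IsMinimalIdempotent e)
    (hfree : ∀ α : autGroup T X, (∀ x, π (α.1 x) = π x) → ∀ x, α.1 x = x) :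
    ∃ C : Z → Equiv.Perm (eRange e), (∀ z x, π (C z x) = π x + z) ∧ C 0 = 1 ∧
      ∀ (α : autGroup T X) (ξ z : Z), (∀ x, π (α.1 x) = π x + ξ) →
        autRestrict e α * C z = C (z + ξ) := by
  let r : Z → Z := fun z => (QuotientAddGroup.mk z : Z ⧸ autShifts T π).out
  have hr : ∀ z, z - r z ∈ autShifts T π := fun z => by
    have h : (QuotientAddGroup.mk (r z) : Z ⧸ autShifts T π) = QuotientAddGroup.mk z :=
      QuotientAddGroup.out_eq' _
    rw [QuotientAddGroup.eq] at h
    rwa [sub_eq_neg_add]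
  have hr' : ∀ z ξ, ξ ∈ autShifts T π → r (z + ξ) = r z := fun z ξ hξ => by
    have h : (QuotientAddGroup.mk (z + ξ) : Z ⧸ autShifts T π) = QuotientAddGroup.mk z := by
      rw [eq_comm, QuotientAddGroup.eq, neg_add_cancel_left]
      exact hξ
    simp only [r, h]
  choose a ha using hr
  choose F _ hF using hπ.exists_structureGroup_shift he
  let B : Z → Equiv.Perm (eRange e) := fun z => autRestrict e (a z) * F (r z)
  have hB : ∀ z x, π (B z x) = π x + z := fun z x => by
    change π ((a z).1 (F (r z) x)) = _
    rw [ha, hF, add_assoc, add_sub_cancel]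
  have hBα : ∀ (α : autGroup T X) (ξ z : Z), (∀ x, π (α.1 x) = π x + ξ) →
      autRestrict e α * B z = B (z + ξ) := by
    intro α ξ z hα
    refine Equiv.ext fun x => Subtype.ext ?_
    change α.1 ((a z).1 (F (r z) x)) = (a (z + ξ)).1 (F (r (z + ξ)) x)
    have hrz := hr' z ξ ⟨α, hα⟩
    rw [hrz, ← Homeomorph.symm_apply_eq]
    -- Automorphisms with equal shifts coincide, by freeness.
    refine hfree ((a (z + ξ))⁻¹ * (α * a z)) (fun x => ?_) _
    have h := ha (z + ξ) ((a (z + ξ)).1.symm (α.1 ((a z).1 x)))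
    rw [Homeomorph.apply_symm_apply, hα, ha, hrz] at h
    change π ((a (z + ξ)).1.symm (α.1 ((a z).1 x))) = _
    rw [← sub_eq_iff_eq_add] at h
    rw [← h]
    abel
  have hB0 : ∀ x, π ((B 0)⁻¹ x) = π x := fun x => by
    have h := hB 0 ((B 0)⁻¹ x)
    rw [perm_apply_inv, add_zero] at h
    exact h.symm
  -- The normalisation at 0 is made on the right, since automorphisms act on the left.
  refine ⟨fun z => B z * (B 0)⁻¹, fun z x => ?_, mul_inv_cancel _, fun α ξ z hα => ?_⟩
  · rw [Equiv.Perm.mul_apply, hB, hB0]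
  · rw [← mul_assoc, hBα α ξ z hα]

/-- A point x over z gets the coordinates z and (C z)⁻¹ x. Automorphisms then translate the first
coordinate only, so covariance becomes periodicity under `autShifts`, a condition that applying φ to
the values preserves. -/
theorem IsGroupFactor.exists_trivialisation (hπ : IsGroupFactor T π) (he : IsMinimalIdempotent e)
    (hfree : ∀ α : autGroup T X, (∀ x, π (α.1 x) = π x) → ∀ x, α.1 x = x) :
    ∃ Ξ : eRange e ≃ Z × eFibre π e, (∀ x, (Ξ x).1 = π x) ∧
      (∀ y, Ξ.symm (0, y) = inclusion (eFibre_subset π e) y) ∧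
      ∀ (α : autGroup T X) (ξ z : Z) y, (∀ x, π (α.1 x) = π x + ξ) →
        autRestrict e α (Ξ.symm (z, y)) = Ξ.symm (z + ξ, y) := by
  obtain ⟨C, hC, hC0, hCα⟩ := hπ.exists_transport he hfree
  have hCinv : ∀ z x, π ((C z)⁻¹ x) = π x - z := fun z x => by
    rw [eq_sub_iff_add_eq, ← hC, perm_apply_inv]
  let Ξ : eRange e ≃ Z × eFibre π e :=
    { toFun := fun x => (π x, ⟨(C (π x))⁻¹ x, (hπ.mem_eFibre_iff he).2
        ⟨((C (π x))⁻¹ x).2, by rw [hCinv, sub_self]⟩⟩)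
      invFun := fun p => C p.1 (inclusion (eFibre_subset π e) p.2)
      left_inv := fun x => perm_apply_inv (C (π x)) x
      right_inv := fun p => by
        have h : π (C p.1 (inclusion (eFibre_subset π e) p.2)) = p.1 := by
          rw [hC, show π (inclusion (eFibre_subset π e) p.2) = 0 from hπ.map_eFibre he p.2,
            zero_add]
        refine Prod.ext h (Subtype.ext ?_)
        change (((C (π (C p.1 (inclusion (eFibre_subset π e) p.2))))⁻¹ (C p.1 _) : eRange e) : X)
          = p.2
        rw [h, perm_inv_apply] }
  refine ⟨Ξ, fun x => rfl, fun y => ?_, fun α ξ z y hα => ?_⟩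
  · change C 0 _ = _
    rw [hC0]
    rfl
  · exact Equiv.congr_fun (hCα α ξ z hα) _

/-- Every automorphism of the permutation group of the fibre of `0` extends to the group of all
covariant permutations. -/
theorem IsGroupFactor.exists_mulEquiv_extension (hπ : IsGroupFactor T π)
    (he : IsMinimalIdempotent e) {E : Equiv.Perm (eFibre π e) →* covariantGroup π e}
    (hE : IsExtensionHom E) (φ : Equiv.Perm (eFibre π e) ≃* Equiv.Perm (eFibre π e)) :
    ∃ Φ : covariantGroup π e ≃* covariantGroup π e, ∀ a, Φ (E a) = E (φ a) := by
  classical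
  by_cases hfree : ∀ α : autGroup T X, (∀ x, π (α.1 x) = π x) → ∀ x, α.1 x = x
  · obtain ⟨Ξ, hΞ1, hΞ0, hΞα⟩ := hπ.exists_trivialisation he hfree
    have := hπ.nonempty_eFibre (e := e)
    have hΞs : ∀ z y, π (Ξ.symm (z, y)) = z := fun z y => by
      rw [← hΞ1, Equiv.apply_symm_apply]
    obtain ⟨Φ, hΦ⟩ := exists_wreath_mulEquiv Ξ (covariantGroup π e)
      (fun c => ∀ z, ∀ ξ ∈ autShifts T π, c (z + ξ) = c z) (fun g => by
        constructor
        · intro hg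
          obtain ⟨ξ, hξ⟩ := hg.1
          obtain ⟨c, hc⟩ := exists_eq_wreathPerm Ξ g ξ fun x => by rw [hΞ1, hΞ1, hξ]
          refine ⟨ξ, c, fun z ζ ⟨α, hα⟩ => Equiv.ext fun y => ?_, hc⟩
          have h := covariantGroup_apply_comm hg α (Ξ.symm (z, y))
          rw [hc, hΞα α ζ z y hα, wreathPerm_apply_symm, wreathPerm_apply_symm,
            hΞα α ζ _ _ hα] at h
          exact congrArg Prod.snd (Ξ.symm.injective h)
        · rintro ⟨ξ, c, hc, rfl⟩
          refine ⟨⟨ξ, fun x => ?_⟩, fun α => Equiv.ext fun x => ?_⟩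
          · obtain ⟨⟨z, y⟩, rfl⟩ := Ξ.symm.surjective x
            rw [wreathPerm_apply_symm, hΞs, hΞs]
          · obtain ⟨ζ, hα⟩ := hπ.aut_shift α
            obtain ⟨⟨z, y⟩, rfl⟩ := Ξ.symm.surjective x
            rw [Equiv.Perm.mul_apply, Equiv.Perm.mul_apply, hΞα α ζ z y hα,
              wreathPerm_apply_symm, wreathPerm_apply_symm, hΞα α ζ _ _ hα, hc z ζ ⟨α, hα⟩,
              add_right_comm])
      (fun φ c hc z ξ hξ => congrArg φ (hc z ξ hξ)) φ
    have hEa : ∀ a, (E a).1 = wreathPerm Ξ 0 fun z => if z ∈ autShifts T π then a else 1 := by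
      intro a
      refine Equiv.ext fun x => ?_
      by_cases hx : π x ∈ autShifts T π
      · obtain ⟨α, y, rfl⟩ := hπ.exists_autRestrict_inclusion_eq he hx
        obtain ⟨ζ, hα⟩ := hπ.aut_shift α
        rw [covariantGroup_apply_comm (E a).2, (hE a).2, ← hΞ0, ← hΞ0, hΞα α ζ _ _ hα,
          hΞα α ζ _ _ hα, wreathPerm_apply_symm, add_zero, zero_add, if_pos ⟨α, hα⟩]
      · rw [(hE a).1.2 x hx]
        obtain ⟨⟨z, y⟩, rfl⟩ := Ξ.symm.surjective x
        rw [hΞs] at hx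
        rw [wreathPerm_apply_symm, add_zero, if_neg hx]
        rfl
    refine ⟨Φ, fun a => Subtype.ext ?_⟩
    rw [hΦ _ _ _ (hEa a), hEa]
    congr 1
    funext z
    split_ifs
    · rfl
    · exact map_one φ
  -- By minimality a nontrivial fibre-preserving automorphism has no fixed point, so it acts on Y as
  -- some c ≠ 1. Since every permutation of Y extends covariantly, c is central.
  · push Not at hfree
    obtain ⟨α, hα, x, hx⟩ := hfree
    obtain ⟨c, hc⟩ := hπ.exists_restrict he (b := autRestrict e α) fun x => hα x
    have hne : c ≠ 1 := by
      rintro rfl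
      obtain ⟨y⟩ := hπ.nonempty_eFibre (e := e)
      exact hx (aut_eq_one_of_fixed (x := (y : X)) (congrArg Subtype.val (hc y)) x)
    have hcomm : ∀ h, c * h = h * c := by
      refine fun h => Equiv.ext fun y => inclusion_injective (eFibre_subset π e) ?_
      rw [Equiv.Perm.mul_apply, Equiv.Perm.mul_apply, ← hc, ← (hE h).2, ← (hE h).2, ← hc,
        covariantGroup_apply_comm (E h).2]
    exact ⟨MulEquiv.refl _, fun a => by rw [perm_mulEquiv_eq_self hcomm hne]; rfl⟩

end Extension

theorem mainTheorem9 {T : Type w} [CommGroup T] {X Z : Type u}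
    -- a minimal system on a compact Hausdorff space
    [TopologicalSpace X] [CompactSpace X] [T2Space X]
    [MulAction T X] [ContinuousConstSMul T X] [MulAction.IsMinimal T X]
    -- its maximal equicontinuous factor, a compact group on which `T` acts by translations
    [AddCommGroup Z] [TopologicalSpace Z] [IsTopologicalAddGroup Z] [CompactSpace Z] [T2Space Z]
    [MulAction T Z] [ContinuousConstSMul T Z] (hZ : ∀ (t : T) (z : Z), t • z = z + t • (0 : Z))
    (π : X → Z) (hπ : IsMaximalEquicontinuousFactor T π)
    (hUSF : IsUSF T π)
    (e : ellis T X) (he : IsMinimalIdempotent e)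
    (hΓ : ∀ h : Equiv.Perm (eFibre π e),
      h ∈ topNormalClosure (structureGroupFibZero π e he) (littleStructureGroupZero π e)) :
    -- the structure group consists of all covariant functions
    structureGroup e he = covariantGroup π e ∧
    -- the restriction to the fibre of `0` has a matrix form over the full permutation group
    (∃ (I Λ : Type u) (A : Λ → I → Equiv.Perm (eFibre π e)),
      Nonempty (ReesMatrix A ≃* fibKernelZero T π)) ∧
    -- every such matrix form determines the kernel
    ∀ (I Λ : Type*) (A : Λ → I → Equiv.Perm (eFibre π e)),
      Nonempty (ReesMatrix A ≃* fibKernelZero T π) →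
      ∃ A' : Λ → I → covariantGroup π e,
        (∀ l i, IsCovariantExtension π e (A l i) (A' l i)) ∧
        Nonempty (ReesMatrix A' ≃* ellisKernel T X) := by
  have hπ' : IsGroupFactor T π := ⟨hπ.isFactorMap, hZ⟩
  have hG := hπ'.structureGroup_eq hUSF he hΓ
  obtain ⟨E, hE⟩ := hπ'.exists_extensionHom he fun h => (hΓ h).1
  obtain ⟨I₀, Λ₀, A₀, ⟨Ψ₀⟩, ⟨Ψ⟩⟩ := hπ'.exists_kernel_matrix hUSF he hG.ge hE
  refine ⟨hG, ⟨I₀, Λ₀, A₀, ⟨Ψ₀⟩⟩, ?_⟩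
  rintro I Λ A ⟨Θ⟩
  -- The restriction of e witnesses that the index sets are nonempty, which supplies the base point
  -- for comparing the matrices.
  have x := (Θ.trans Ψ₀.symm).symm (Ψ₀.symm (fibRestrict T π (fibLift hπ' he hG.ge hE 1)))
  have : Nonempty I := ⟨x.row⟩
  have : Nonempty Λ := ⟨x.col⟩
  obtain ⟨σ, τ, φ, u, v, h⟩ := ReesMatrix.exists_equivalence_of_equiv (Θ.trans Ψ₀.symm)
  obtain ⟨Φ, hΦ⟩ := hπ'.exists_mulEquiv_extension he hE φ
  refine ⟨fun l i => E (A l i), fun l i => hE.isCovariantExtension hπ' (A l i), ⟨?_⟩⟩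
  -- E carries the equivalence over S_Y to one over the covariant group, with Φ in place of φ.
  exact (ReesMatrix.equivOfEquivalent σ τ Φ (fun i => E (u i)) (fun l => E (v l))
    fun l i => by rw [hΦ, h, map_mul, map_mul]).trans Ψ
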